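/- Let $k\ge 1$, let $\lambda^{(1)}_j,\lambda^{(2)}_j>0$ for $1\le j\le k$, and let $\alpha,\beta\in(0,1)$. For $i=1,2$ let $\{M_i(s,t):s,t\ge0\}$ be a generalized Poisson random field on $\mathbb R_+^2$ with rates $\lambda^{(i)}_1,\dots,\lambda^{(i)}_k$. That is, $M_i$ takes values in $\mathbb N_0$; $M_i(0,t)=M_i(s,0)=0$ almost surely; the increments $M_i(s',t')-M_i(s',t)-M_i(s,t')+M_i(s,t)$ over disjoint rectangles $(s,s']\times(t,t']$ are independent; the increment over a rectangle of area $a>0$ equals $n\in\mathbb N_0$ with probability $\sum_{n_1+2n_2+\dots+kn_k=n}\prod_{j=1}^k\frac{(\lambda^{(i)}_ja)^{n_j}}{n_j!}e^{-\lambda^{(i)}_ja}$; and almost surely the paths are continuous from the upper right (as for $M_i(s,t)=M_i([0,s]\times[0,t])$ with a random measure $M_i$). Let $\mathcal S=M_1-M_2$. Let $L^\alpha$, $L^\beta$ be inverse stable subordinators, $L^\gamma(t)=\inf\{r\ge0:H^\gamma(r)\ge t\}$, where $H^\gamma$ is a Lévy process with almost surely nondecreasing paths and $\mathbb E e^{-uH^\gamma(t)}=e^{-tu^\gamma}$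 for $u>0$. Suppose that the processes $M_1,M_2,L^\alpha,L^\beta$ are mutually independent, and put $\mathcal S^{\alpha,\beta}(s,t)=\mathcal S(L^\alpha(s),L^\beta(t))$. For $z\in(0,1]$ put $\phi(z)=\sum_{j=1}^k\big(\lambda_j^{(1)}(1-z^j)+\lambda_j^{(2)}(1-z^{-j})\big)$, and consider the generalized Wright function $${}_2\Psi_2\Bigg[\begin{matrix}(1,1),&(1,1)\\(1,\alpha),&(1,\beta)\end{matrix}\,\bigg|\,x\Bigg]=\sum_{r=0}^\infty\frac{\Gamma(r+1)^2}{\Gamma(\alpha r+1)\,\Gamma(\beta r+1)\,r!}\,x^r .$$ Let $z\in(0,1]$, $s,t\ge0$ and $x=-\phi(z)s^\alpha t^\beta$. (a) If this series converges at $x$, then $\mathbb E z^{\mathcal S^{\alpha,\beta}(s,t)}<\infty$ and $$\mathbb E z^{\mathcal S^{\alpha,\beta}(s,t)}={}_2\Psi_2\Bigg[\begin{matrix}(1,1),&(1,1)\\(1,\alpha),&(1,\beta)\end{matrix}\,\bigg|\,-\phi(z)s^\alpha t^\beta\Bigg].$$ (b) The series converges at $x$ if $\alpha+\beta>1$, and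 also if $\alpha+\beta=1$ and $|x|<\alpha^\alpha\beta^\beta$. (c) If $\phi(z)s^\alpha t^\beta\le0$, the identity in (a) holds without any condition on convergence as an identity in $[0,\infty]$. -/

import Mathlib

open MeasureTheory ProbabilityTheory Filter
open scoped NNReal ENNReal Topology Nat

noncomputable section

namespace FracSkellam

/-! ### The generalized Wright function -/

/-- The `r`-th term of the series defining the generalized Wright function with upper parameters
`(a i, A i)`, `i < m`, and lower parameters `(b j, B j)`, `j < l`. -/
def wrightTerm {m l : ℕ} (a A : Fin m → ℝ) (b B : Fin l → ℝ) (x : ℝ) (r : ℕ) : ℝ :=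
  (∏ i, Real.Gamma (A i * r + a i)) / ((∏ j, Real.Gamma (B j * r + b j)) * (r ! : ℝ)) * x ^ r

/-- The partial sums of the generalized Wright series converge at `x`. -/
def WrightConverges {m l : ℕ} (a A : Fin m → ℝ) (b B : Fin l → ℝ) (x : ℝ) : Prop :=
  ∃ v : ℝ, Tendsto (fun n : ℕ => ∑ r ∈ Finset.range n, wrightTerm a A b B x r) atTop (𝓝 v)

/-- The generalized Wright function `ₘΨₗ` at `x`: the limit of the partial sums of its series
(meaningful where `WrightConverges` holds). -/
def wrightPsi {m l : ℕ} (a A : Fin m → ℝ) (b B : Fin l → ℝ) (x : ℝ) : ℝ :=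
  limUnder atTop (fun n : ℕ => ∑ r ∈ Finset.range n, wrightTerm a A b B x r)

/-! ### The generalized Poisson random field on the quadrant -/

/-- `Θ(k,n)`: tuples `(n₁,…,n_k)` of natural numbers with `∑ j n_j = n`; the index `j : Fin k`
stands for `j + 1`. -/
def theta (k n : ℕ) : Finset (Fin k → ℕ) :=
  (Fintype.piFinset fun _ : Fin k => Finset.range (n + 1)).filter
    fun c => ∑ j : Fin k, ((j : ℕ) + 1) * c j = n

theorem mem_theta {k n : ℕ} {c : Fin k → ℕ} :
    c ∈ theta k n ↔ ∑ j : Fin k, ((j : ℕ) + 1) * c j = n := by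
  unfold theta
  rw [Finset.mem_filter, Fintype.mem_piFinset]
  refine ⟨fun h => h.2, fun h => ⟨fun j => ?_, h⟩⟩
  have h1 : ((j : ℕ) + 1) * c j ≤ ∑ i : Fin k, ((i : ℕ) + 1) * c i :=
    Finset.single_le_sum (f := fun i : Fin k => ((i : ℕ) + 1) * c i)
      (fun _ _ => Nat.zero_le _) (Finset.mem_univ j)
  have h2 : c j ≤ ((j : ℕ) + 1) * c j := Nat.le_mul_of_pos_left _ (Nat.succ_pos _)
  rw [Finset.mem_range]
  omega

/-- The probability that the field has `n` points in a rectangle of area `area`. -/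
def gprfMass {k : ℕ} (lam : Fin k → ℝ) (area : ℝ) (n : ℕ) : ℝ :=
  ∑ c ∈ theta k n, ∏ j : Fin k, (lam j * area) ^ c j / ((c j)! : ℝ) * Real.exp (-(lam j * area))

/-- The rectangular increment of `X` over `(s,s'] × (t,t']`, where `p = (s,t)`, `q = (s',t')`. -/
def rectIncr {Ω : Type*} (X : ℝ≥0 × ℝ≥0 → Ω → ℕ) (p q : ℝ≥0 × ℝ≥0) (ω : Ω) : ℤ :=
  (X q ω : ℤ) - X (q.1, p.2) ω - X (p.1, q.2) ω + X p ω

/-- The rectangle `(s,s'] × (t,t']`, where `p = (s,t)`, `q = (s',t')`. -/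
def rect (p q : ℝ≥0 × ℝ≥0) : Set (ℝ≥0 × ℝ≥0) :=
  Set.Ioc p.1 q.1 ×ˢ Set.Ioc p.2 q.2

/-- `M` is a generalized Poisson random field on the quadrant with rates `lam`: a two-parameter
Lévy process with rectangular increments that vanishes on the axes and whose increments have the
mass function `gprfMass`. -/
structure IsGPRF {Ω : Type*} [MeasurableSpace Ω] {k : ℕ} (lam : Fin k → ℝ)
    (M : ℝ≥0 × ℝ≥0 → Ω → ℕ) (P : Measure Ω) : Prop where
  rate_pos : ∀ j, 0 < lam j
  measurable : ∀ p, Measurable (M p)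
  zero_left : ∀ t, ∀ᵐ ω ∂P, M (0, t) ω = 0
  zero_right : ∀ s, ∀ᵐ ω ∂P, M (s, 0) ω = 0
  /-- Law of the increment over a nondegenerate rectangle. -/
  law_incr : ∀ p q : ℝ≥0 × ℝ≥0, p.1 < q.1 → p.2 < q.2 → ∀ n : ℕ,
    P.real {ω | rectIncr M p q ω = n} =
      gprfMass lam (((q.1 : ℝ) - p.1) * ((q.2 : ℝ) - p.2)) n
  /-- Increments over pairwise disjoint rectangles are mutually independent. -/
  indep_incr : ∀ (m : ℕ) (p q : Fin m → ℝ≥0 × ℝ≥0), (∀ i, p i ≤ q i) →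
    (Pairwise fun i j => Disjoint (rect (p i) (q i)) (rect (p j) (q j))) →
    iIndepFun (fun i => rectIncr M (p i) (q i)) P
  /-- Almost all paths are continuous from the upper right, as is automatic when `M (s, t)` is
  the mass that a locally finite random measure gives to `[0,s] × [0,t]`. -/
  right_cont : ∀ᵐ ω ∂P, ∀ p, ContinuousWithinAt (fun q => M q ω) (Set.Ici p) p

/-! ### Inverse stable subordinators -/

/-- One-parameter real-valued Lévy process. -/
structure IsLevyProcess {Ω : Type*} [MeasurableSpace Ω] (H : ℝ≥0 → Ω → ℝ)
    (P : Measure Ω) : Prop where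
  measurable : ∀ t, Measurable (H t)
  zero : ∀ᵐ ω ∂P, H 0 ω = 0
  indep_incr : HasIndepIncrements H P
  stationary_incr : ∀ s h : ℝ≥0, IdentDistrib (fun ω => H (s + h) ω - H s ω) (H h) P P
  right_cont : ∀ᵐ ω ∂P, ∀ t, ContinuousWithinAt (fun r => H r ω) (Set.Ici t) t
  left_lim : ∀ᵐ ω ∂P, ∀ t, ∃ l, Tendsto (fun r => H r ω) (𝓝[<] t) (𝓝 l)

/-- A stable subordinator of index `α`: a Lévy process with almost surely nondecreasing paths
(hence almost surely nonnegative) and Laplace transform `exp (-t u ^ α)`. -/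
structure IsStableSubordinator {Ω : Type*} [MeasurableSpace Ω] (α : ℝ) (H : ℝ≥0 → Ω → ℝ)
    (P : Measure Ω) : Prop where
  levy : IsLevyProcess H P
  mono : ∀ᵐ ω ∂P, Monotone fun t => H t ω
  laplace : ∀ (t : ℝ≥0) (u : ℝ), 0 < u →
    ∫ ω, Real.exp (-(u * H t ω)) ∂P = Real.exp (-(t * u ^ α))

/-- `L` is an inverse stable subordinator of index `α`: the hitting time process
`L t = inf {s ≥ 0 : H s ≥ t}` of some stable subordinator `H` of index `α`. (The set is almost
surely nonempty, since `H s → ∞` almost surely.) -/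
def IsInverseStable {Ω : Type*} [MeasurableSpace Ω] (α : ℝ) (L : ℝ≥0 → Ω → ℝ≥0)
    (P : Measure Ω) : Prop :=
  ∃ H : ℝ≥0 → Ω → ℝ, IsStableSubordinator α H P ∧
    ∀ t ω, L t ω = sInf {s : ℝ≥0 | (t : ℝ) ≤ H s ω}

/-! ### The fractional generalized Skellam point process -/

/-- The σ-algebra generated by a process. -/
@[reducible] def sigmaOf {Ω T E : Type*} [MeasurableSpace E] (X : T → Ω → E) : MeasurableSpace Ω :=
  ⨆ t, MeasurableSpace.comap (X t) inferInstance

/-- The generalized Skellam point process `M₁ - M₂`. -/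
def skellam {Ω : Type*} (M₁ M₂ : ℝ≥0 × ℝ≥0 → Ω → ℕ) (p : ℝ≥0 × ℝ≥0) (ω : Ω) : ℤ :=
  (M₁ p ω : ℤ) - M₂ p ω

/-- The time-changed process `S (L s, K t)`, where `S = M₁ - M₂`. -/
def fracSkellam {Ω : Type*} (M₁ M₂ : ℝ≥0 × ℝ≥0 → Ω → ℕ) (L K : ℝ≥0 → Ω → ℝ≥0)
    (s t : ℝ≥0) (ω : Ω) : ℤ :=
  skellam M₁ M₂ (L s ω, K t ω) ω

/-- `φ(z) = ∑ j, (λ_j⁽¹⁾ (1 - z ^ j) + λ_j⁽²⁾ (1 - z ^ (-j)))`, with `j : Fin k` standing for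
`j + 1`. -/
def phi {k : ℕ} (lam₁ lam₂ : Fin k → ℝ) (z : ℝ) : ℝ :=
  ∑ j : Fin k, (lam₁ j * (1 - z ^ ((j : ℤ) + 1)) + lam₂ j * (1 - z ^ (-((j : ℤ) + 1))))

end FracSkellam

end

namespace FracSkellam

/-! ### The probability generating function of the generalized Poisson law -/

/-! Over a rectangle of area `A` each field is distributed as `∑ j N_j` with independent Poisson
`N_j`, so `M₁ - M₂` has generating function `exp (-φ(z) A)` there (`tsum_gprfMass_mul_pow`).
Averaging over the independent random corner reduces the theorem to `E exp (c W)`, where `c = -φ(z)`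
and `W = L^α(s) L^β(t)` (`lintegral_zpow_fracSkellam`). Expanding the exponential gives the series
`∑ c ^ r E W ^ r / r!`, and independence splits `E W ^ r` into two moments `r! s ^ (α r) / Γ(α r +
1)`, one for each factor. This is the Wright series at `x`.

The moments come from the duality `L(s) > y ↔ H(y) < s`. The layer-cake integral of `P (H(y) < s)`
and the claimed power of `s` have the same Laplace transform in `s`; uniqueness gives equality
almost everywhere, and monotonicity against continuity gives it at every `s > 0`
(`IsStableSubordinator.lintegral_measure_lt_mul_rpow`).

Conditioning on the random corner needs care because no joint measurability of the fields is
assumed. The corner is moved to a grid point above and to the right, where only countably many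
values occur and independence applies directly; continuity from the upper right then permits the
limit (`measure_timeChange_eq`).

For `c ≥ 0` sum and expectation interchange by Tonelli. For `c < 0` the series may converge only
conditionally, and Abel's theorem replaces absolute convergence (`integral_exp_of_tendsto_moments`).
The sufficient conditions for convergence follow from a lower bound on `B(α r + 1, β r + 1)` and
log-convexity of Gamma. -/

theorem tsum_pi_prod_eq_prod_tsum : ∀ {k : ℕ} (f : Fin k → ℕ → ℝ≥0∞),
    ∑' c : Fin k → ℕ, ∏ j, f j (c j) = ∏ j, ∑' m, f j m
  | 0, f => by simp
  | k + 1, f => by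
    rw [← (Fin.consEquiv fun _ : Fin (k + 1) => ℕ).tsum_eq, Fin.prod_univ_succ,
      ← tsum_pi_prod_eq_prod_tsum fun j : Fin k => f j.succ, ← ENNReal.tsum_mul_right]
    simp_rw [← ENNReal.tsum_mul_left]
    rw [← ENNReal.tsum_prod (f := fun (a : ℕ) (c : Fin k → ℕ) => f 0 a * ∏ i, f i.succ (c i))]
    refine tsum_congr fun p => ?_
    simp [Fin.consEquiv, Fin.prod_univ_succ]

/-- The finite sets `theta k n` are the fibres of the weight `c ↦ ∑ j c_j`, so they partition all
tuples. -/
theorem tsum_sum_theta {k : ℕ} (g : (Fin k → ℕ) → ℝ≥0∞) :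
    ∑' n, ∑ c ∈ theta k n, g c = ∑' c, g c := by
  rw [← (Equiv.sigmaFiberEquiv fun c : Fin k → ℕ => ∑ j : Fin k, ((j : ℕ) + 1) * c j).tsum_eq g,
    ENNReal.tsum_sigma']
  refine tsum_congr fun n => ?_
  rw [← Finset.tsum_subtype]
  exact (Equiv.subtypeEquivRight fun c => mem_theta).tsum_eq
    fun c : {c : Fin k → ℕ // ∑ j : Fin k, ((j : ℕ) + 1) * c j = n} => g c

theorem gprfMass_nonneg {k : ℕ} {lam : Fin k → ℝ} (hlam : ∀ j, 0 < lam j) {A : ℝ} (hA : 0 ≤ A)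
    (n : ℕ) : 0 ≤ gprfMass lam A n := by
  unfold gprfMass
  have := fun j => (hlam j).le
  exact Finset.sum_nonneg fun c _ => Finset.prod_nonneg fun j _ => by
    have := this j; positivity

theorem continuous_gprfMass {k : ℕ} (lam : Fin k → ℝ) (n : ℕ) :
    Continuous fun A => gprfMass lam A n := by
  unfold gprfMass
  fun_prop

theorem gprfMass_zero_right {k : ℕ} (lam : Fin k → ℝ) (n : ℕ) :
    gprfMass lam 0 n = if n = 0 then 1 else 0 := by
  unfold gprfMass
  split_ifs with hn
  · subst hn
    rw [Finset.sum_eq_single_of_mem (0 : Fin k → ℕ) (mem_theta.2 (by simp))]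
    · simp
    · intro c hc hc0
      rw [mem_theta, Finset.sum_eq_zero_iff] at hc
      exact absurd (funext fun j => by simpa using hc j (Finset.mem_univ j)) hc0
  · refine Finset.sum_eq_zero fun c hc => ?_
    obtain ⟨j, hj⟩ : ∃ j, c j ≠ 0 := by
      by_contra! h
      rw [mem_theta] at hc
      exact hn (by simpa [h] using hc.symm)
    exact Finset.prod_eq_zero (Finset.mem_univ j) (by simp [hj])

theorem tsum_poisson_pgf {a w : ℝ} (ha : 0 ≤ a) (hw : 0 ≤ w) :
    ∑' m : ℕ, ENNReal.ofReal (a ^ m / (m ! : ℝ) * Real.exp (-a) * w ^ m) =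
      ENNReal.ofReal (Real.exp (-(a * (1 - w)))) := by
  have h : HasSum (fun m : ℕ => a ^ m / (m ! : ℝ) * Real.exp (-a) * w ^ m)
      (Real.exp (-(a * (1 - w)))) := by
    have h1 := (NormedSpace.expSeries_div_hasSum_exp (𝔸 := ℝ) (a * w)).mul_left (Real.exp (-a))
    rw [← Real.exp_eq_exp_ℝ, ← Real.exp_add] at h1
    convert! h1 using 2 with m
    · rw [mul_pow]; ring
    · ring
  rw [← h.tsum_eq, ENNReal.ofReal_tsum_of_nonneg (fun m => by positivity) h.summable]

/-- On `theta k n` the factor `w ^ n` splits as `∏ (w ^ j) ^ c_j`, so the sum over all tuples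
factors into Poisson generating functions at `w ^ j`. Working in `ℝ≥0∞` removes summability
questions; `w` may exceed 1, as is needed for `z⁻¹`. -/
theorem tsum_gprfMass_mul_pow {k : ℕ} {lam : Fin k → ℝ} (hlam : ∀ j, 0 < lam j) {A w : ℝ}
    (hA : 0 ≤ A) (hw : 0 ≤ w) :
    ∑' n : ℕ, ENNReal.ofReal (gprfMass lam A n * w ^ n) =
      ENNReal.ofReal (Real.exp (-(A * ∑ j : Fin k, lam j * (1 - w ^ ((j : ℕ) + 1))))) := by
  have hnn : ∀ (j : Fin k) (m : ℕ), 0 ≤ (lam j * A) ^ m / (m ! : ℝ) *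
      Real.exp (-(lam j * A)) * (w ^ ((j : ℕ) + 1)) ^ m := fun j m => by
    have := (hlam j).le; positivity
  have hterm : ∀ n : ℕ, ENNReal.ofReal (gprfMass lam A n * w ^ n) = ∑ c ∈ theta k n,
      ∏ j : Fin k, ENNReal.ofReal ((lam j * A) ^ c j / ((c j)! : ℝ) * Real.exp (-(lam j * A)) *
        (w ^ ((j : ℕ) + 1)) ^ c j) := by
    intro n
    rw [gprfMass, Finset.sum_mul, ENNReal.ofReal_sum_of_nonneg]
    · refine Finset.sum_congr rfl fun c hc => ?_
      rw [← ENNReal.ofReal_prod_of_nonneg fun j _ => hnn j _, Finset.prod_mul_distrib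
        (g := fun j : Fin k => (w ^ ((j : ℕ) + 1)) ^ c j)]
      simp_rw [← pow_mul]
      rw [Finset.prod_pow_eq_pow_sum, mem_theta.1 hc]
    · intro c _
      have := fun j => (hlam j).le
      exact mul_nonneg (Finset.prod_nonneg fun j _ => by have := this j; positivity)
        (by positivity)
  simp_rw [hterm]
  rw [tsum_sum_theta fun c => ∏ j : Fin k, ENNReal.ofReal ((lam j * A) ^ c j / ((c j)! : ℝ) *
    Real.exp (-(lam j * A)) * (w ^ ((j : ℕ) + 1)) ^ c j), tsum_pi_prod_eq_prod_tsum
      fun j m => ENNReal.ofReal ((lam j * A) ^ m / (m ! : ℝ) * Real.exp (-(lam j * A)) *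
        (w ^ ((j : ℕ) + 1)) ^ m)]
  rw [Finset.prod_congr rfl fun j _ => tsum_poisson_pgf (mul_nonneg (hlam j).le hA)
    (by positivity : 0 ≤ w ^ ((j : ℕ) + 1)), ← ENNReal.ofReal_prod_of_nonneg fun j _ => by
      positivity, ← Real.exp_sum, Finset.mul_sum, ← Finset.sum_neg_distrib]
  congr 2
  exact Finset.sum_congr rfl fun j _ => by ring

/-! ### One-dimensional laws of the field -/

theorem IsGPRF.prob_eq {Ω : Type*} [MeasurableSpace Ω] {P : Measure Ω} [IsProbabilityMeasure P]
    {k : ℕ} {lam : Fin k → ℝ} {M : ℝ≥0 × ℝ≥0 → Ω → ℕ} (hM : IsGPRF lam M P) (q : ℝ≥0 × ℝ≥0)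
    (n : ℕ) : P {ω | M q ω = n} = ENNReal.ofReal (gprfMass lam ((q.1 : ℝ) * q.2) n) := by
  obtain ⟨u, v⟩ := q
  have key : ((u : ℝ) * v = 0) → (∀ᵐ ω ∂P, M (u, v) ω = 0) →
      P {ω | M (u, v) ω = n} = ENNReal.ofReal (gprfMass lam ((u : ℝ) * v) n) := by
    intro h0 h
    rw [h0, gprfMass_zero_right]
    have h1 : {ω | M (u, v) ω = n} =ᵐ[P] {_ω | n = 0} := by
      filter_upwards [h] with ω hω
      exact propext (show M (u, v) ω = n ↔ n = 0 by rw [hω, eq_comm])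
    rw [measure_congr h1]
    split_ifs with hn <;> simp [hn]
  -- `law_incr` covers only nondegenerate rectangles, so the axes are treated separately.
  rcases eq_or_ne u 0 with rfl | hu
  · exact key (by simp) (hM.zero_left v)
  rcases eq_or_ne v 0 with rfl | hv
  · exact key (by simp) (hM.zero_right u)
  have h := hM.law_incr (0, 0) (u, v) (pos_iff_ne_zero.2 hu) (pos_iff_ne_zero.2 hv) n
  have h1 : {ω | rectIncr M (0, 0) (u, v) ω = n} =ᵐ[P] {ω | M (u, v) ω = n} := by
    filter_upwards [hM.zero_left 0, hM.zero_left v, hM.zero_right u] with ω h1 h2 h3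
    exact propext (show rectIncr M (0, 0) (u, v) ω = n ↔ M (u, v) ω = n by
      simp [rectIncr, h1, h2, h3])
  rw [measureReal_def, measure_congr h1] at h
  simp only [NNReal.coe_zero, sub_zero] at h
  rw [← h, ENNReal.ofReal_toReal (measure_ne_top _ _)]

/-! ### Exponential moments from power moments -/

section ExpMoments

variable {Ω : Type*} [MeasurableSpace Ω] {P : Measure Ω} {W : Ω → ℝ} {m : ℕ → ℝ}

/-- Tonelli applied to the exponential series; `0 ≤ c` makes all its terms nonnegative, so both
sides may be infinite. -/
theorem lintegral_exp_eq_tsum_moments (hW : AEMeasurable W P) (hW0 : ∀ᵐ ω ∂P, 0 ≤ W ω)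
    (hmom : ∀ r : ℕ, ∫⁻ ω, ENNReal.ofReal (W ω ^ r) ∂P = ENNReal.ofReal (m r))
    {c : ℝ} (hc : 0 ≤ c) :
    ∫⁻ ω, ENNReal.ofReal (Real.exp (c * W ω)) ∂P =
      ∑' r : ℕ, ENNReal.ofReal (c ^ r * (m r / (r ! : ℝ))) := by
  have h1 : ∀ᵐ ω ∂P, ENNReal.ofReal (Real.exp (c * W ω)) =
      ∑' r : ℕ, ENNReal.ofReal (c ^ r / (r ! : ℝ)) * ENNReal.ofReal (W ω ^ r) := by
    filter_upwards [hW0] with ω hω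
    have h := NormedSpace.expSeries_div_hasSum_exp (𝔸 := ℝ) (c * W ω)
    rw [← Real.exp_eq_exp_ℝ] at h
    rw [← h.tsum_eq, ENNReal.ofReal_tsum_of_nonneg (fun r => by positivity) h.summable]
    refine tsum_congr fun r => ?_
    rw [← ENNReal.ofReal_mul (by positivity), mul_pow]
    congr 1
    ring
  rw [lintegral_congr_ae h1, lintegral_tsum fun r =>
    (hW.pow_const r).ennreal_ofReal.const_mul _]
  refine tsum_congr fun r => ?_
  rw [lintegral_const_mul'' _ (hW.pow_const r).ennreal_ofReal, hmom,
    ← ENNReal.ofReal_mul (by positivity)]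
  congr 1
  ring

/-- The version for signed `c`: the absolute series sums the `L¹` norms of the terms, which
justifies termwise integration. -/
theorem integral_exp_of_summable_moments (hW : AEMeasurable W P) (hW0 : ∀ᵐ ω ∂P, 0 ≤ W ω)
    (hm : ∀ r, 0 ≤ m r)
    (hmom : ∀ r : ℕ, ∫⁻ ω, ENNReal.ofReal (W ω ^ r) ∂P = ENNReal.ofReal (m r))
    {c : ℝ} (hs : Summable fun r : ℕ => |c| ^ r * (m r / (r ! : ℝ))) :
    Integrable (fun ω => Real.exp (c * W ω)) P ∧
      HasSum (fun r : ℕ => c ^ r * (m r / (r ! : ℝ))) (∫ ω, Real.exp (c * W ω) ∂P) := by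
  have habs : Integrable (fun ω => Real.exp (|c| * W ω)) P := by
    refine ⟨(Real.measurable_exp.comp_aemeasurable (hW.const_mul _)).aestronglyMeasurable, ?_⟩
    rw [hasFiniteIntegral_iff_ofReal (ae_of_all _ fun ω => (Real.exp_pos _).le),
      lintegral_exp_eq_tsum_moments hW hW0 hmom (abs_nonneg c),
      ← ENNReal.ofReal_tsum_of_nonneg (fun r => by have := hm r; positivity) hs]
    exact ENNReal.ofReal_lt_top
  have hint : ∀ r : ℕ, Integrable (fun ω => W ω ^ r) P := fun r => by
    refine ⟨(hW.pow_const r).aestronglyMeasurable, ?_⟩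
    rw [hasFiniteIntegral_iff_ofReal (by filter_upwards [hW0] with ω hω using by positivity), hmom]
    exact ENNReal.ofReal_lt_top
  have hval : ∀ r : ℕ, ∫ ω, W ω ^ r ∂P = m r := fun r => by
    rw [integral_eq_lintegral_of_nonneg_ae
      (by filter_upwards [hW0] with ω hω using by positivity)
      (hW.pow_const r).aestronglyMeasurable, hmom, ENNReal.toReal_ofReal (hm r)]
  constructor
  · refine habs.mono (Real.measurable_exp.comp_aemeasurable
      (hW.const_mul _)).aestronglyMeasurable ?_
    filter_upwards [hW0] with ω hω
    simp only [Real.norm_eq_abs, Real.abs_exp]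
    exact Real.exp_le_exp.2 (mul_le_mul_of_nonneg_right (le_abs_self c) hω)
  · have hF : ∀ r : ℕ, ∫ ω, ‖c ^ r / (r ! : ℝ) * W ω ^ r‖ ∂P = |c| ^ r * (m r / (r ! : ℝ)) := by
      intro r
      have : ∀ᵐ ω ∂P, ‖c ^ r / (r ! : ℝ) * W ω ^ r‖ = |c| ^ r / (r ! : ℝ) * W ω ^ r := by
        filter_upwards [hW0] with ω hω
        rw [norm_mul, norm_div, norm_pow, norm_pow, Real.norm_eq_abs, Real.norm_of_nonneg hω,
          Real.norm_of_nonneg (by positivity : (0 : ℝ) ≤ (r ! : ℝ))]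
      rw [integral_congr_ae this, integral_const_mul, hval]
      ring
    have h := hasSum_integral_of_summable_integral_norm
      (F := fun (r : ℕ) ω => c ^ r / (r ! : ℝ) * W ω ^ r) (μ := P)
      (fun r => (hint r).const_mul _) (by simpa only [hF] using hs)
    have hsum : ∀ ω, ∑' r : ℕ, c ^ r / (r ! : ℝ) * W ω ^ r = Real.exp (c * W ω) := fun ω => by
      rw [Real.exp_eq_exp_ℝ, ← (NormedSpace.expSeries_div_hasSum_exp (𝔸 := ℝ) (c * W ω)).tsum_eq]
      exact tsum_congr fun r => by rw [mul_pow]; ring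
    simp only [hsum, integral_const_mul, hval] at h
    convert! h using 2
    ring

/-- The exponential moment is the sum of the moment series wherever the latter converges, even
conditionally (on the boundary of the disc of convergence, by Abel's theorem). -/
theorem integral_exp_of_tendsto_moments [IsFiniteMeasure P] (hW : AEMeasurable W P)
    (hW0 : ∀ᵐ ω ∂P, 0 ≤ W ω) (hm : ∀ r, 0 ≤ m r)
    (hmom : ∀ r : ℕ, ∫⁻ ω, ENNReal.ofReal (W ω ^ r) ∂P = ENNReal.ofReal (m r)) {c v : ℝ}
    (hv : Tendsto (fun n : ℕ => ∑ r ∈ Finset.range n, c ^ r * (m r / (r ! : ℝ))) atTop (𝓝 v)) :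
    Integrable (fun ω => Real.exp (c * W ω)) P ∧ ∫ ω, Real.exp (c * W ω) ∂P = v := by
  rcases le_or_gt 0 c with hc | hc
  · have hnn : ∀ r : ℕ, 0 ≤ c ^ r * (m r / (r ! : ℝ)) := fun r => by have := hm r; positivity
    have hs : HasSum (fun r : ℕ => c ^ r * (m r / (r ! : ℝ))) v :=
      (hasSum_iff_tendsto_nat_of_nonneg hnn v).2 hv
    have h := integral_exp_of_summable_moments hW hW0 hm hmom (c := c)
      (by rw [abs_of_nonneg hc]; exact hs.summable)
    exact ⟨h.1, h.2.unique hs⟩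
  have hmeas : ∀ d : ℝ, AEStronglyMeasurable (fun ω => Real.exp (d * W ω)) P := fun d =>
    (Real.measurable_exp.comp_aemeasurable (hW.const_mul d)).aestronglyMeasurable
  refine ⟨(integrable_const (1 : ℝ)).mono (hmeas c) ?_, ?_⟩
  · filter_upwards [hW0] with ω hω
    simpa using mul_nonpos_of_nonpos_of_nonneg hc.le hω
  -- Abel: the series at `ρ c` tends to `v` as `ρ ↑ 1`. For `ρ < 1` it converges absolutely, since
  -- the terms at `c` are bounded, and equals `E exp (ρ c W)`. As `c < 0 ≤ W`, these exponentials
  -- are at most 1 and dominated convergence identifies the limit.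
  have habel := Real.tendsto_tsum_powerSeries_nhdsWithin_lt hv
  have hbdd : ∃ C, ∀ r : ℕ, |c ^ r * (m r / (r ! : ℝ))| ≤ C := by
    have h0 : Tendsto (fun r : ℕ => c ^ r * (m r / (r ! : ℝ))) atTop (𝓝 0) := by
      have := (hv.comp (tendsto_add_atTop_nat 1)).sub hv
      simpa [Function.comp_def, Finset.sum_range_succ] using this
    obtain ⟨C, hC⟩ := h0.abs.bddAbove_range
    exact ⟨C, fun r => hC ⟨r, rfl⟩⟩
  obtain ⟨C, hC⟩ := hbdd
  have hinner : ∀ ρ : ℝ, 0 < ρ → ρ < 1 →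
      ∑' r : ℕ, c ^ r * (m r / (r ! : ℝ)) * ρ ^ r = ∫ ω, Real.exp ((ρ * c) * W ω) ∂P := by
    intro ρ hρ0 hρ1
    have hs : Summable fun r : ℕ => |ρ * c| ^ r * (m r / (r ! : ℝ)) := by
      refine Summable.of_nonneg_of_le (fun r => by have := hm r; positivity) (fun r => ?_)
        ((summable_geometric_of_lt_one hρ0.le hρ1).mul_left C)
      have h1 := hC r
      rw [abs_mul, abs_pow, abs_of_nonneg (div_nonneg (hm r) (Nat.cast_nonneg _))] at h1
      rw [abs_mul, abs_of_pos hρ0, mul_pow, mul_assoc, mul_comm]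
      exact mul_le_mul_of_nonneg_right h1 (by positivity)
    rw [← (integral_exp_of_summable_moments hW hW0 hm hmom hs).2.tsum_eq]
    exact tsum_congr fun r => by rw [mul_pow]; ring
  have hlim : Tendsto (fun ρ : ℝ => ∫ ω, Real.exp ((ρ * c) * W ω) ∂P) (𝓝[<] 1)
      (𝓝 (∫ ω, Real.exp (c * W ω) ∂P)) := by
    refine tendsto_integral_filter_of_dominated_convergence (fun _ => (1 : ℝ))
      (Eventually.of_forall fun ρ => hmeas _) ?_ (integrable_const _) ?_
    · filter_upwards [Ioo_mem_nhdsLT (zero_lt_one' ℝ)] with ρ hρ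
      filter_upwards [hW0] with ω hω
      simpa using mul_nonpos_of_nonpos_of_nonneg (mul_neg_of_pos_of_neg hρ.1 hc).le hω
    · refine ae_of_all _ fun ω => ?_
      have : Continuous fun ρ : ℝ => Real.exp ((ρ * c) * W ω) := by fun_prop
      simpa using (this.tendsto 1).mono_left nhdsWithin_le_nhds
  refine tendsto_nhds_unique (hlim.congr' ?_) habel
  filter_upwards [Ioo_mem_nhdsLT (zero_lt_one' ℝ)] with ρ hρ
  exact (hinner ρ hρ.1 hρ.2).symm

end ExpMoments

/-! ### Convergence of the Wright series -/

theorem wrightTerm_eq (α β x : ℝ) (r : ℕ) :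
    wrightTerm ![1, 1] ![1, 1] ![1, 1] ![α, β] x r =
      (r ! : ℝ) / (Real.Gamma (α * r + 1) * Real.Gamma (β * r + 1)) * x ^ r := by
  have h0 : (r ! : ℝ) ≠ 0 := by positivity
  simp only [wrightTerm, Fin.prod_univ_two, Matrix.cons_val_zero, Matrix.cons_val_one, one_mul,
    Real.Gamma_nat_eq_factorial]
  field_simp

theorem beta_eq_integral {a b : ℝ} (ha : 0 ≤ a) (hb : 0 ≤ b) :
    beta (a + 1) (b + 1) = ∫ u in (0 : ℝ)..1, u ^ a * (1 - u) ^ b := by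
  rw [beta_eq_betaIntegralReal _ _ (by linarith) (by linarith), Complex.betaIntegral,
    ← Complex.ofReal_re (∫ u in (0 : ℝ)..1, u ^ a * (1 - u) ^ b), ← intervalIntegral.integral_ofReal]
  congr 1
  refine intervalIntegral.integral_congr fun u hu => ?_
  rw [Set.uIcc_of_le zero_le_one] at hu
  simp only [Complex.ofReal_add, Complex.ofReal_one, add_sub_cancel_right, Complex.ofReal_mul]
  rw [Complex.ofReal_cpow hu.1, Complex.ofReal_cpow (by linarith [hu.2])]
  simp

/-- Laplace's method in its crudest form: `Beta (α r + 1, β r + 1) ≥ δ c ^ r` for each `c` below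
the maximum of `u ^ α (1 - u) ^ β` at `u = α / (α + β)`. -/
theorem exists_le_beta {α β : ℝ} (hα : 0 < α) (hβ : 0 < β) {c : ℝ} (hc0 : 0 ≤ c)
    (hc : c < (α / (α + β)) ^ α * (β / (α + β)) ^ β) :
    ∃ δ > 0, ∀ r : ℕ, δ * c ^ r ≤ beta (α * r + 1) (β * r + 1) := by
  have hcont : Continuous fun u : ℝ => u ^ α * (1 - u) ^ β :=
    (Real.continuous_rpow_const hα.le).mul
      ((Real.continuous_rpow_const hβ.le).comp (by fun_prop))
  set u₀ := α / (α + β) with hu₀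
  have h01 : u₀ ∈ Set.Ioo (0 : ℝ) 1 := ⟨by positivity, by rw [hu₀, div_lt_one] <;> linarith⟩
  have hv : 1 - u₀ = β / (α + β) := by rw [hu₀]; field_simp; ring
  have hev : ∀ᶠ u in 𝓝 u₀, c < u ^ α * (1 - u) ^ β ∧ u ∈ Set.Ioo (0 : ℝ) 1 :=
    (hcont.continuousAt.eventually (lt_mem_nhds (by simpa only [hv] using hc))).and
      (isOpen_Ioo.mem_nhds h01)
  obtain ⟨ε, hε, hball⟩ := Metric.eventually_nhds_iff_ball.1 hev
  -- To the right of the maximizer the base `u ^ α (1 - u) ^ β` stays above `c` on an interval of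
  -- length `ε / 2`; that length serves as `δ`.
  have hsub : ∀ u ∈ Set.Icc u₀ (u₀ + ε / 2), c < u ^ α * (1 - u) ^ β ∧ u ∈ Set.Ioo (0 : ℝ) 1 :=
    fun u hu => hball u (by
      rw [Metric.mem_ball, Real.dist_eq, abs_lt]; constructor <;> linarith [hu.1, hu.2])
  refine ⟨ε / 2, by positivity, fun r => ?_⟩
  have hcontr : Continuous fun u : ℝ => u ^ (α * r) * (1 - u) ^ (β * r) :=
    (Real.continuous_rpow_const (by positivity)).mul
      ((Real.continuous_rpow_const (by positivity)).comp (by fun_prop))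
  rw [beta_eq_integral (by positivity) (by positivity)]
  have hlast := (hsub (u₀ + ε / 2) ⟨by linarith, le_rfl⟩).2.2
  calc ε / 2 * c ^ r = ∫ _u in u₀..(u₀ + ε / 2), c ^ r := by simp
    _ ≤ ∫ u in u₀..(u₀ + ε / 2), u ^ (α * r) * (1 - u) ^ (β * r) := by
        refine intervalIntegral.integral_mono_on (by linarith) (by simp)
          (hcontr.intervalIntegrable _ _) fun u hu => ?_
        obtain ⟨h1, h2⟩ := hsub u hu
        rw [Real.rpow_mul h2.1.le, Real.rpow_mul (by linarith [h2.2]), Real.rpow_natCast,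
          Real.rpow_natCast, ← mul_pow]
        exact pow_le_pow_left₀ hc0 h1.le r
    _ ≤ ∫ u in (0 : ℝ)..1, u ^ (α * r) * (1 - u) ^ (β * r) := by
        refine intervalIntegral.integral_mono_interval h01.1.le (by linarith) hlast.le ?_
          (hcontr.intervalIntegrable _ _)
        filter_upwards [ae_restrict_mem measurableSet_Ioc] with u hu
        exact mul_nonneg (Real.rpow_nonneg hu.1.le _) (Real.rpow_nonneg (by linarith [hu.2]) _)

/-- A consequence of the log-convexity of the Gamma function. -/
theorem Gamma_mul_rpow_le {y h : ℝ} (hy : 0 < y) (hh : 0 ≤ h) :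
    Real.Gamma (y + 1) * y ^ h ≤ Real.Gamma (y + 1 + h) := by
  rcases hh.eq_or_lt with rfl | hh
  · simp
  have h1 : 0 < y + 1 := by linarith
  have h2 : 0 < y + 1 + h := by linarith
  -- The slope of `log Γ` on `[y, y + 1]` is `log y` by the functional equation; convexity bounds it
  -- by the slope on `[y + 1, y + 1 + h]`.
  have hs := Real.convexOn_log_Gamma.slope_mono_adjacent (x := y) (y := y + 1) (z := y + 1 + h)
    hy h2 (by linarith) (by linarith)
  have hG := Real.Gamma_pos_of_pos hy
  simp only [Function.comp, add_sub_cancel_left, div_one] at hs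
  nth_rewrite 1 [Real.Gamma_add_one hy.ne'] at hs
  rw [Real.log_mul hy.ne' hG.ne', add_sub_cancel_right, le_div_iff₀ hh] at hs
  rw [← Real.log_le_log_iff (mul_pos (Real.Gamma_pos_of_pos h1) (by positivity))
    (Real.Gamma_pos_of_pos h2), Real.log_mul (Real.Gamma_pos_of_pos h1).ne' (by positivity),
    Real.log_rpow hy]
  linarith

/-- This is `Gamma_mul_rpow_le` at `y = r + 1`, `h = (γ - 1) r`, with `Γ(r + 2) = (r + 1)!` weakened
to `r!`. -/
theorem factorial_mul_rpow_le_Gamma {γ : ℝ} (hγ : 1 ≤ γ) (r : ℕ) :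
    (r ! : ℝ) * (((r : ℝ) + 1) ^ (γ - 1)) ^ r ≤ Real.Gamma (γ * r + 2) := by
  have h := Gamma_mul_rpow_le (y := (r : ℝ) + 1) (h := (γ - 1) * r) (by positivity)
    (mul_nonneg (by linarith) (Nat.cast_nonneg r))
  rw [show (r : ℝ) + 1 + 1 + (γ - 1) * r = γ * r + 2 by ring, Real.rpow_mul (by positivity),
    Real.rpow_natCast] at h
  refine le_trans (mul_le_mul_of_nonneg_right ?_ (by positivity)) h
  rw [Real.Gamma_add_one (by positivity), Real.Gamma_nat_eq_factorial]
  nlinarith [Nat.cast_nonneg (α := ℝ) r, Nat.cast_nonneg (α := ℝ) (r !)]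

/-- Write `Γ(α r + 1) Γ(β r + 1)` as `B(α r + 1, β r + 1) Γ((α + β) r + 2)` and bound both factors
from below. The result has the shape required by a root test. -/
theorem abs_wrightTerm_le {α β : ℝ} (hα : 0 < α) (hβ : 0 < β) (hαβ : 1 ≤ α + β) {c δ : ℝ}
    (hc : 0 < c) (hδ : 0 < δ) (h : ∀ r : ℕ, δ * c ^ r ≤ beta (α * r + 1) (β * r + 1)) (x : ℝ)
    (r : ℕ) : |wrightTerm ![1, 1] ![1, 1] ![1, 1] ![α, β] x r| ≤
      δ⁻¹ * (|x| / (c * ((r : ℝ) + 1) ^ (α + β - 1))) ^ r := by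
  have hG1 : 0 < Real.Gamma (α * r + 1) := Real.Gamma_pos_of_pos (by positivity)
  have hG2 : 0 < Real.Gamma (β * r + 1) := Real.Gamma_pos_of_pos (by positivity)
  have hG3 : 0 < Real.Gamma ((α + β) * r + 2) := Real.Gamma_pos_of_pos (by positivity)
  have hr := h r
  rw [beta, show α * (r : ℝ) + 1 + (β * r + 1) = (α + β) * r + 2 by ring, le_div_iff₀ hG3] at hr
  have hf := factorial_mul_rpow_le_Gamma hαβ r
  set p := ((r : ℝ) + 1) ^ (α + β - 1) with hp
  have hp0 : 0 < p := by positivity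
  rw [wrightTerm_eq, abs_mul, abs_pow, abs_of_nonneg (by positivity), div_pow, mul_pow,
    ← mul_div_assoc, div_mul_eq_mul_div, div_le_div_iff₀ (by positivity) (by positivity)]
  have h2 : δ * c ^ r * ((r ! : ℝ) * p ^ r) ≤ Real.Gamma (α * r + 1) * Real.Gamma (β * r + 1) :=
    le_trans (mul_le_mul_of_nonneg_left hf (by positivity)) hr
  have h3 := mul_le_mul_of_nonneg_left h2 (by positivity : 0 ≤ δ⁻¹ * |x| ^ r)
  calc _ = δ⁻¹ * |x| ^ r * (δ * c ^ r * ((r ! : ℝ) * p ^ r)) := by field_simp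
    _ ≤ _ := h3

theorem wrightConverges_of_abs_le {α β x C : ℝ} {q : ℕ → ℝ} {κ : ℝ} (hκ : κ < 1)
    (hq0 : ∀ r, 0 ≤ q r) (hq : ∀ᶠ r in atTop, q r ≤ κ)
    (h : ∀ r : ℕ, |wrightTerm ![1, 1] ![1, 1] ![1, 1] ![α, β] x r| ≤ C * q r ^ r) (hC : 0 ≤ C) :
    WrightConverges ![1, 1] ![1, 1] ![1, 1] ![α, β] x := by
  obtain ⟨r₀, hr₀⟩ := hq.exists
  have hs : Summable fun r => wrightTerm ![1, 1] ![1, 1] ![1, 1] ![α, β] x r := by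
    refine Summable.of_norm_bounded_eventually_nat
      ((summable_geometric_of_lt_one ((hq0 r₀).trans hr₀) hκ).mul_left C) ?_
    filter_upwards [hq] with r hr
    exact (h r).trans (mul_le_mul_of_nonneg_left (pow_le_pow_left₀ (hq0 r) hr r) hC)
  exact ⟨_, hs.hasSum.tendsto_sum_nat⟩

/-- The factor `(r + 1) ^ (α + β - 1)` tends to infinity, so any positive `c` below the maximum
suffices; half the maximum is taken. -/
theorem wrightConverges_of_one_lt {α β : ℝ} (hα : 0 < α) (hβ : 0 < β) (hαβ : 1 < α + β) (x : ℝ) :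
    WrightConverges ![1, 1] ![1, 1] ![1, 1] ![α, β] x := by
  have hR : 0 < (α / (α + β)) ^ α * (β / (α + β)) ^ β := by positivity
  obtain ⟨δ, hδ, h⟩ := exists_le_beta hα hβ (half_pos hR).le (half_lt_self hR)
  have hlim : Tendsto (fun r : ℕ => |x| / ((α / (α + β)) ^ α * (β / (α + β)) ^ β / 2 *
      ((r : ℝ) + 1) ^ (α + β - 1))) atTop (𝓝 0) := by
    refine Tendsto.div_atTop tendsto_const_nhds (Tendsto.const_mul_atTop (half_pos hR) ?_)
    exact (tendsto_rpow_atTop (by linarith)).comp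
      (tendsto_atTop_add_const_right _ _ tendsto_natCast_atTop_atTop)
  exact wrightConverges_of_abs_le one_half_lt_one (fun r => by positivity)
    (hlim.eventually (ge_mem_nhds one_half_pos))
    (abs_wrightTerm_le hα hβ hαβ.le (half_pos hR) hδ h x) (by positivity)

/-- For `α + β = 1` the maximum of `u ^ α (1 - u) ^ β` is `α ^ α β ^ β`; a `c` strictly between
`|x|` and it gives a geometric bound. -/
theorem wrightConverges_of_abs_lt {α β : ℝ} (hα : 0 < α) (hβ : 0 < β) (hαβ : α + β = 1) {x : ℝ}
    (hx : |x| < α ^ α * β ^ β) : WrightConverges ![1, 1] ![1, 1] ![1, 1] ![α, β] x := by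
  obtain ⟨c, hxc, hcR⟩ := exists_between hx
  have hc : 0 < c := (abs_nonneg x).trans_lt hxc
  obtain ⟨δ, hδ, h⟩ := exists_le_beta hα hβ hc.le (by simpa [hαβ] using hcR)
  have hb := abs_wrightTerm_le hα hβ hαβ.ge hc hδ h x
  simp only [hαβ, sub_self, Real.rpow_zero, mul_one] at hb
  exact wrightConverges_of_abs_le ((div_lt_one hc).2 hxc) (fun _ => by positivity)
    (Eventually.of_forall fun _ => le_rfl) hb (by positivity)

/-! ### Grid approximation from the right -/

/-- The grid point of mesh `1 / (n + 1)` that follows `i / (n + 1)`. -/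
noncomputable def gridPoint (n i : ℕ) : ℝ≥0 := ((i : ℝ≥0) + 1) / ((n : ℝ≥0) + 1)

/-- The index of the grid cell of mesh `1 / (n + 1)` that contains `y`. -/
noncomputable def gridIndex (n : ℕ) (y : ℝ≥0) : ℕ := ⌊((n : ℝ≥0) + 1) * y⌋₊

theorem measurable_gridIndex (n : ℕ) : Measurable (gridIndex n) :=
  Nat.measurable_floor.comp (measurable_const.mul measurable_id)

theorem le_gridPoint (n : ℕ) (y : ℝ≥0) : y ≤ gridPoint n (gridIndex n y) := by
  rw [gridPoint, le_div_iff₀ (by positivity), mul_comm]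
  exact (Nat.lt_floor_add_one _).le

theorem gridPoint_le (n : ℕ) (y : ℝ≥0) :
    gridPoint n (gridIndex n y) ≤ y + 1 / ((n : ℝ≥0) + 1) := by
  have h : (gridIndex n y : ℝ≥0) ≤ ((n : ℝ≥0) + 1) * y := Nat.floor_le zero_le
  rw [gridPoint, div_le_iff₀ (by positivity), add_mul, div_mul_cancel₀ _ (by positivity)]
  gcongr
  rwa [mul_comm]

/-- The limit lies in `𝓝[≥] y`, so that one-sided continuity of the paths is enough. -/
theorem tendsto_gridPoint (y : ℝ≥0) :
    Tendsto (fun n => gridPoint n (gridIndex n y)) atTop (𝓝[≥] y) := by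
  refine tendsto_nhdsWithin_iff.2 ⟨?_, Eventually.of_forall fun n => le_gridPoint n y⟩
  refine tendsto_of_tendsto_of_tendsto_of_le_of_le tendsto_const_nhds ?_
    (fun n => le_gridPoint n y) fun n => gridPoint_le n y
  have h : Tendsto (fun n : ℕ => 1 / ((n : ℝ≥0) + 1)) atTop (𝓝 0) :=
    tendsto_one_div_add_atTop_nhds_zero_nat
  simpa using tendsto_const_nhds.add h

/-! ### Stable subordinators -/

section Subordinator

variable {Ω : Type*} [MeasurableSpace Ω] {P : Measure Ω} {α : ℝ} {H : ℝ≥0 → Ω → ℝ}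

theorem IsStableSubordinator.ae_nonneg (hH : IsStableSubordinator α H P) :
    ∀ᵐ ω ∂P, ∀ y, 0 ≤ H y ω := by
  filter_upwards [hH.mono, hH.levy.zero] with ω h1 h2 y
  rw [← h2]
  exact h1 zero_le

theorem IsStableSubordinator.lintegral_exp (hH : IsStableSubordinator α H P) (y : ℝ≥0) {u : ℝ}
    (hu : 0 < u) : ∫⁻ ω, ENNReal.ofReal (Real.exp (-(u * H y ω))) ∂P =
      ENNReal.ofReal (Real.exp (-(y * u ^ α))) := by
  have h := hH.laplace y u hu
  rw [← h, ofReal_integral_eq_lintegral_ofReal]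
  -- The Bochner integral of a non-integrable function is 0, so a positive value forces
  -- integrability.
  · exact Integrable.of_integral_ne_zero (by rw [h]; positivity)
  · exact ae_of_all _ fun ω => (Real.exp_pos _).le

/-- Chernoff bound: `P (H n < N) ≤ exp N * E exp (-H n) = exp (N - n)`, which tends to 0 in `n`.
This keeps the infimum defining `L` away from the default `sInf ∅ = 0`. -/
theorem IsStableSubordinator.ae_exists_ge (hH : IsStableSubordinator α H P) :
    ∀ᵐ ω ∂P, ∀ s : ℝ, ∃ y, s ≤ H y ω := by
  have key : ∀ N : ℕ, ∀ᵐ ω ∂P, ∃ y, (N : ℝ) ≤ H y ω := by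
    intro N
    have hbound : ∀ n : ℕ, P {ω | ¬ ∃ y, (N : ℝ) ≤ H y ω} ≤
        ENNReal.ofReal (Real.exp N * Real.exp (-(n : ℝ))) := by
      intro n
      calc P {ω | ¬ ∃ y, (N : ℝ) ≤ H y ω}
          ≤ P {ω | 1 ≤ ENNReal.ofReal (Real.exp N * Real.exp (-(1 * H n ω)))} := by
            refine measure_mono fun ω hω => ?_
            simp only [Set.mem_ofPred_eq, not_exists, not_le] at hω ⊢
            rw [← Real.exp_add, ENNReal.one_le_ofReal]
            exact Real.one_le_exp (by linarith [hω n])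
        _ ≤ ∫⁻ ω, ENNReal.ofReal (Real.exp N * Real.exp (-(1 * H n ω))) ∂P := by
            have hm := hH.levy.measurable n
            have := mul_meas_ge_le_lintegral (μ := P)
              (f := fun ω => ENNReal.ofReal (Real.exp N * Real.exp (-(1 * H n ω))))
              (by fun_prop) 1
            simpa using this
        _ = _ := by
            simp_rw [ENNReal.ofReal_mul (Real.exp_pos (N : ℝ)).le]
            rw [lintegral_const_mul' _ _ ENNReal.ofReal_ne_top, hH.lintegral_exp n one_pos]
            simp
    have hlim : Tendsto (fun n : ℕ => ENNReal.ofReal (Real.exp N * Real.exp (-(n : ℝ)))) atTop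
        (𝓝 0) := by
      have h1 : Tendsto (fun n : ℕ => Real.exp N * Real.exp (-(n : ℝ))) atTop (𝓝 0) := by
        simpa using (Real.tendsto_exp_neg_atTop_nhds_zero.comp
          tendsto_natCast_atTop_atTop).const_mul (Real.exp N)
      simpa using ENNReal.tendsto_ofReal h1
    exact le_antisymm (ge_of_tendsto' hlim hbound) zero_le
  filter_upwards [ae_all_iff.2 key] with ω hω s
  obtain ⟨N, hN⟩ := exists_nat_ge s
  obtain ⟨y, hy⟩ := hω N
  exact ⟨y, hN.trans hy⟩

theorem IsStableSubordinator.ae_lt_sInf_iff (hH : IsStableSubordinator α H P) :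
    ∀ᵐ ω ∂P, ∀ s y : ℝ≥0, y < sInf {r : ℝ≥0 | (s : ℝ) ≤ H r ω} ↔ H y ω < s := by
  filter_upwards [hH.mono, hH.levy.right_cont, hH.ae_exists_ge] with ω hmono hrc hex s y
  constructor
  · intro h
    by_contra! hle
    exact (csInf_le (s := {r : ℝ≥0 | (s : ℝ) ≤ H r ω}) (OrderBot.bddBelow _) hle).not_gt h
  · intro h
    -- Right continuity keeps `H` below `s` slightly beyond `y`; by monotonicity the infimum then
    -- exceeds `y` strictly.
    have hev : ∀ᶠ r in 𝓝[>] y, H r ω < s :=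
      ((hrc y).mono Set.Ioi_subset_Ici_self).eventually (gt_mem_nhds h)
    obtain ⟨r, hr, hyr⟩ := (hev.and self_mem_nhdsWithin).exists
    refine lt_of_lt_of_le hyr (le_csInf (hex s) fun r' hr' => ?_)
    by_contra! hlt
    exact absurd (hr'.trans (hmono hlt.le)) hr.not_ge

/-- Supplies the joint measurability for Tonelli in level and time. With the time on a grid the
probability is monotone in the level; right continuity passes to the limit. -/
theorem IsStableSubordinator.measurable_measure_lt (hH : IsStableSubordinator α H P)
    [IsProbabilityMeasure P] :
    Measurable fun p : ℝ × ℝ => P {ω | H p.2.toNNReal ω < p.1} := by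
  refine measurable_of_tendsto_metrizable (f := fun (n : ℕ) (p : ℝ × ℝ) =>
    P {ω | H (gridPoint n (gridIndex n p.2.toNNReal)) ω < p.1}) (fun n => ?_) ?_
  · have h1 : Measurable fun q : ℝ × ℕ => P {ω | H (gridPoint n q.2) ω < q.1} := by
      refine measurable_from_prod_countable_left fun i => Monotone.measurable ?_
      intro a b hab
      exact measure_mono fun ω hω => lt_of_lt_of_le hω hab
    have h2 : Measurable fun p : ℝ × ℝ => (p.1, gridIndex n p.2.toNNReal) :=
      measurable_fst.prodMk ((measurable_gridIndex n).comp
        (measurable_real_toNNReal.comp measurable_snd))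
    simpa only [Function.comp_def] using h1.comp h2
  · rw [tendsto_pi_nhds]
    rintro ⟨s, y⟩
    refine tendsto_measure_of_ae_tendsto_indicator_of_isFiniteMeasure atTop
      (measurableSet_lt (hH.levy.measurable _) measurable_const)
      (fun n => measurableSet_lt (hH.levy.measurable _) measurable_const) ?_
    filter_upwards [hH.mono, hH.levy.right_cont] with ω hmono hrc
    by_cases h : H y.toNNReal ω < s
    · have hev := (hrc y.toNNReal).eventually (gt_mem_nhds h)
      filter_upwards [(tendsto_gridPoint y.toNNReal).eventually hev] with n hn
      exact iff_of_true hn h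
    · refine Eventually.of_forall fun n => iff_of_false (fun hn => h ?_) h
      exact (hmono (le_gridPoint n y.toNNReal)).trans_lt hn

end Subordinator

/-! ### Laplace transforms -/

theorem lintegral_Ioi_exp {u : ℝ} (hu : 0 < u) (c : ℝ) :
    ∫⁻ s in Set.Ioi c, ENNReal.ofReal (Real.exp (-(u * s))) =
      ENNReal.ofReal (Real.exp (-(u * c)) / u) := by
  have h := integral_exp_mul_Ioi (neg_lt_zero.2 hu) c
  have hi : IntegrableOn (fun s => Real.exp (-(u * s))) (Set.Ioi c) :=
    Integrable.of_integral_ne_zero (by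
      simp only [← neg_mul, h]
      have := Real.exp_pos (-u * c)
      simp [hu.ne'])
  rw [← ofReal_integral_eq_lintegral_ofReal hi (ae_of_all _ fun s => (Real.exp_pos _).le)]
  simp only [← neg_mul, h, neg_div_neg_eq]

theorem lintegral_Ioi_rpow_mul_exp {a u : ℝ} (ha : 0 < a) (hu : 0 < u) :
    ∫⁻ s in Set.Ioi (0 : ℝ), ENNReal.ofReal (s ^ (a - 1) * Real.exp (-(u * s))) =
      ENNReal.ofReal (u ^ (-a) * Real.Gamma a) := by
  have h := Real.integral_rpow_mul_exp_neg_mul_Ioi ha hu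
  rw [one_div, Real.inv_rpow hu.le, ← Real.rpow_neg hu.le] at h
  have hG := Real.Gamma_pos_of_pos ha
  rw [← h, ofReal_integral_eq_lintegral_ofReal]
  · exact Integrable.of_integral_ne_zero (by rw [h]; positivity)
  · filter_upwards [ae_restrict_mem measurableSet_Ioi] with s hs
    exact mul_nonneg (Real.rpow_nonneg (le_of_lt hs) _) (Real.exp_pos _).le

/-- Finite measures on `[0, 1]` are determined by their moments. -/
theorem measure_ext_of_moments {μ ν : Measure ℝ} [IsFiniteMeasure μ] [IsFiniteMeasure ν]
    (hμ : ∀ᵐ x ∂μ, x ∈ Set.Icc (0 : ℝ) 1) (hν : ∀ᵐ x ∂ν, x ∈ Set.Icc (0 : ℝ) 1)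
    (h : ∀ n : ℕ, ∫ x, x ^ n ∂μ = ∫ x, x ^ n ∂ν) : μ = ν := by
  -- The characteristic function is a power series in the moments, convergent for all `t` because
  -- the moments are bounded by the total mass.
  have key : ∀ (ρ : Measure ℝ) [IsFiniteMeasure ρ], (∀ᵐ x ∂ρ, x ∈ Set.Icc (0 : ℝ) 1) → ∀ t : ℝ,
      HasSum (fun n : ℕ => (t * Complex.I) ^ n / (n ! : ℂ) * ((∫ x, x ^ n ∂ρ : ℝ) : ℂ))
        (charFun ρ t) := by
    intro ρ _ hρ t
    have hle : ∀ n : ℕ, ∀ᵐ x ∂ρ, ‖(x ^ n : ℝ)‖ ≤ 1 := fun n => by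
      filter_upwards [hρ] with x hx
      rw [norm_pow, Real.norm_of_nonneg hx.1]
      exact pow_le_one₀ hx.1 hx.2
    have hint : ∀ n : ℕ, Integrable (fun x : ℝ => x ^ n) ρ := fun n =>
      (integrable_const (1 : ℝ)).mono (by fun_prop) (by simpa using hle n)
    have hnorm : ∀ (n : ℕ) (x : ℝ), ‖(t * Complex.I) ^ n / (n ! : ℂ) * ((x ^ n : ℝ) : ℂ)‖ =
        |t| ^ n / (n ! : ℝ) * ‖(x ^ n : ℝ)‖ := fun n x => by
      simp
    have hs := hasSum_integral_of_summable_integral_norm (μ := ρ)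
      (F := fun (n : ℕ) (x : ℝ) => (t * Complex.I) ^ n / (n ! : ℂ) * ((x ^ n : ℝ) : ℂ))
      (fun n => (hint n).ofReal.const_mul _) (by
        simp only [hnorm]
        refine Summable.of_nonneg_of_le (fun n => integral_nonneg fun x => by positivity)
          (fun n => ?_) ((Real.summable_pow_div_factorial |t|).mul_right (ρ.real Set.univ))
        rw [integral_const_mul]
        refine mul_le_mul_of_nonneg_left ?_ (by positivity)
        calc ∫ x, ‖(x ^ n : ℝ)‖ ∂ρ ≤ ∫ _x, (1 : ℝ) ∂ρ :=
              integral_mono_ae (hint n).norm (integrable_const _) (hle n)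
          _ = _ := by simp)
    simp only [integral_const_mul, integral_complex_ofReal] at hs
    convert! hs using 1
    rw [charFun_apply_real]
    refine integral_congr_ae (ae_of_all _ fun x => ?_)
    have := NormedSpace.expSeries_div_hasSum_exp (𝔸 := ℂ) (t * x * Complex.I)
    rw [← Complex.exp_eq_exp_ℂ] at this
    show Complex.exp (t * x * Complex.I) = _
    rw [← this.tsum_eq]
    refine tsum_congr fun n => ?_
    push_cast
    rw [show (t : ℂ) * x * Complex.I = t * Complex.I * x by ring, mul_pow]
    ring
  refine Measure.ext_of_charFun (funext fun t => ?_)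
  have h1 := key μ hμ t
  simp only [h] at h1
  exact h1.unique (key ν hν t)

/-- Nonnegative functions on the half-line with the same finite Laplace transform at the positive
integers agree almost everywhere. -/
theorem ae_eq_of_laplace_eq {f g : ℝ → ℝ≥0∞} (hf : Measurable f) (hg : Measurable g)
    (hfin : ∫⁻ s in Set.Ioi (0 : ℝ), ENNReal.ofReal (Real.exp (-(1 * s))) * f s ≠ ∞)
    (h : ∀ u : ℝ, 0 < u → ∫⁻ s in Set.Ioi (0 : ℝ), ENNReal.ofReal (Real.exp (-(u * s))) * f s =
      ∫⁻ s in Set.Ioi (0 : ℝ), ENNReal.ofReal (Real.exp (-(u * s))) * g s) :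
    f =ᵐ[volume.restrict (Set.Ioi (0 : ℝ))] g := by
  have hexp : Measurable fun s : ℝ => ENNReal.ofReal (Real.exp (-(1 * s))) := by fun_prop
  -- The map `s ↦ exp (-s)` sends the finite measure `exp (-s) f(s) ds` to one on `[0, 1]` whose
  -- `n`-th moment is the Laplace transform of `f` at `n + 1`.
  set e : ℝ → ℝ := fun s => Real.exp (-s) with he
  have hem : MeasurableEmbedding e :=
    Measurable.measurableEmbedding (by fun_prop) fun a b hab => by
      simpa [he] using hab
  let ρ : (ℝ → ℝ≥0∞) → Measure ℝ := fun f' => (volume.restrict (Set.Ioi (0 : ℝ))).withDensity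
    fun s => ENNReal.ofReal (Real.exp (-(1 * s))) * f' s
  have hfinite : ∀ f', ∫⁻ s in Set.Ioi (0 : ℝ), ENNReal.ofReal (Real.exp (-(1 * s))) * f' s ≠ ∞ →
      IsFiniteMeasure (ρ f') := fun f' hf' => isFiniteMeasure_withDensity hf'
  have hsupp : ∀ f', ∀ᵐ x ∂(ρ f').map e, x ∈ Set.Icc (0 : ℝ) 1 := by
    intro f'
    rw [hem.ae_map_iff]
    refine (withDensity_absolutelyContinuous _ _).ae_le ?_
    filter_upwards [ae_restrict_mem measurableSet_Ioi] with s hs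
    exact ⟨(Real.exp_pos _).le, Real.exp_le_one_iff.2 (neg_nonpos.2 (le_of_lt hs))⟩
  have hmom : ∀ f', Measurable f' → ∀ n : ℕ, ∫ x, x ^ n ∂(ρ f').map e =
      (∫⁻ s in Set.Ioi (0 : ℝ), ENNReal.ofReal (Real.exp (-(((n : ℝ) + 1) * s))) * f' s).toReal := by
    intro f' hf' n
    rw [hem.integral_map, integral_eq_lintegral_of_nonneg_ae (ae_of_all _ fun s => by
      simp only [he]; positivity) (by simp only [he]; fun_prop),
      show ρ f' = (volume.restrict (Set.Ioi (0 : ℝ))).withDensity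
        ((fun s => ENNReal.ofReal (Real.exp (-(1 * s)))) * f') from rfl,
      lintegral_withDensity_eq_lintegral_mul _ (hexp.mul hf') (by simp only [he]; fun_prop)]
    congr 1
    refine lintegral_congr fun s => ?_
    show ENNReal.ofReal (Real.exp (-(1 * s))) * f' s * ENNReal.ofReal (e s ^ n) = _
    rw [mul_right_comm, ← ENNReal.ofReal_mul (Real.exp_pos _).le, he]
    simp only
    rw [← Real.exp_nat_mul, ← Real.exp_add]
    congr 3
    ring
  have := hfinite f hfin
  have := hfinite g (by rw [← h 1 one_pos]; exact hfin)
  have hmap : (ρ f).map e = (ρ g).map e :=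
    measure_ext_of_moments (hsupp f) (hsupp g) fun n => by
      rw [hmom f hf, hmom g hg, h _ (by positivity)]
  have hρ : ρ f = ρ g := by
    rw [← hem.comap_map (ρ f), hmap, hem.comap_map]
  have hae := (withDensity_eq_iff (hexp.mul hf).aemeasurable (hexp.mul hg).aemeasurable hfin).1 hρ
  filter_upwards [hae] with s hs
  exact (ENNReal.mul_right_inj (ENNReal.ofReal_pos.2 (Real.exp_pos _)).ne'
    ENNReal.ofReal_ne_top).1 hs

/-- Points of agreement accumulate at `s` from both sides; monotonicity of `f` and continuity of `g`
squeeze `f s`. -/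
theorem eq_of_ae_eq_of_monotone {f g : ℝ → ℝ≥0∞} (hf : Monotone f)
    (h : f =ᵐ[volume.restrict (Set.Ioi (0 : ℝ))] g) {s : ℝ} (hs : 0 < s) (hg : ContinuousAt g s) :
    f s = g s := by
  have hnull : volume {x | ¬ (x ∈ Set.Ioi (0 : ℝ) → f x = g x)} = 0 :=
    (ae_restrict_iff' measurableSet_Ioi).1 h
  have hpos : ∀ a b : ℝ, 0 ≤ a → a < b → ∃ x ∈ Set.Ioo a b, f x = g x := by
    intro a b ha hab
    by_contra! hne
    have hsub : Set.Ioo a b ⊆ {x | ¬ (x ∈ Set.Ioi (0 : ℝ) → f x = g x)} := fun x hx => by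
      simp only [Set.mem_ofPred_eq, Classical.not_imp]
      exact ⟨ha.trans_lt hx.1, hne x hx⟩
    have := measure_mono_null hsub hnull
    rw [Real.volume_Ioo, ENNReal.ofReal_eq_zero] at this
    linarith
  refine le_antisymm ?_ ?_
  · have hfr : ∃ᶠ x in 𝓝[>] s, f s ≤ g x := by
      intro hev
      obtain ⟨b, hb, hsub⟩ := mem_nhdsGT_iff_exists_Ioo_subset.1 hev
      obtain ⟨x, hx, hfx⟩ := hpos s b hs.le hb
      exact hsub hx ((hf hx.1.le).trans_eq hfx)
    exact ge_of_tendsto_of_frequently (hg.mono_left nhdsWithin_le_nhds) hfr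
  · have hfr : ∃ᶠ x in 𝓝[<] s, g x ≤ f s := by
      intro hev
      obtain ⟨a, ha, hsub⟩ := mem_nhdsLT_iff_exists_Ioo_subset.1 hev
      obtain ⟨x, hx, hfx⟩ := hpos (max a 0) s (le_max_right _ _) (max_lt ha hs)
      exact hsub ⟨(le_max_left _ _).trans_lt hx.1, hx.2⟩ (hfx.symm.trans_le (hf hx.2.le))
    exact le_of_tendsto_of_frequently (hg.mono_left nhdsWithin_le_nhds) hfr

section Subordinator

variable {Ω : Type*} [MeasurableSpace Ω] {P : Measure Ω} {α : ℝ}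

/-- By Tonelli the left side is the expectation of the integral of `exp (-u σ)` over `σ > H y`,
which is `exp (-u H y) / u`. -/
theorem IsStableSubordinator.laplace_measure_lt [IsProbabilityMeasure P] {H : ℝ≥0 → Ω → ℝ}
    (hH : IsStableSubordinator α H P) (y : ℝ≥0) {u : ℝ} (hu : 0 < u) :
    ∫⁻ σ in Set.Ioi (0 : ℝ), ENNReal.ofReal (Real.exp (-(u * σ))) * P {ω | H y ω < σ} =
      ENNReal.ofReal (Real.exp (-(y * u ^ α)) / u) := by
  have hset : MeasurableSet {p : ℝ × Ω | H y p.2 < p.1} :=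
    measurableSet_lt ((hH.levy.measurable y).comp measurable_snd) measurable_fst
  have h1 : ∀ σ : ℝ, ENNReal.ofReal (Real.exp (-(u * σ))) * P {ω | H y ω < σ} =
      ∫⁻ ω, {p : ℝ × Ω | H y p.2 < p.1}.indicator
        (fun p => ENNReal.ofReal (Real.exp (-(u * p.1)))) (σ, ω) ∂P := by
    intro σ
    have hm : MeasurableSet {ω | H y ω < σ} :=
      measurableSet_lt (hH.levy.measurable y) measurable_const
    rw [← lintegral_indicator_const hm]
    rfl
  simp_rw [h1]
  rw [lintegral_lintegral_swap (f := fun σ ω => {p : ℝ × Ω | H y p.2 < p.1}.indicator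
    (fun p => ENNReal.ofReal (Real.exp (-(u * p.1)))) (σ, ω))
    (((by fun_prop : Measurable fun p : ℝ × Ω =>
      ENNReal.ofReal (Real.exp (-(u * p.1)))).indicator hset).aemeasurable)]
  have h2 : ∀ᵐ ω ∂P, ∫⁻ σ in Set.Ioi (0 : ℝ), {p : ℝ × Ω | H y p.2 < p.1}.indicator
      (fun p => ENNReal.ofReal (Real.exp (-(u * p.1)))) (σ, ω) =
      ENNReal.ofReal (Real.exp (-(u * H y ω))) * ENNReal.ofReal u⁻¹ := by
    filter_upwards [hH.ae_nonneg] with ω hω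
    have h3 : ∀ σ : ℝ, {p : ℝ × Ω | H y p.2 < p.1}.indicator
        (fun p => ENNReal.ofReal (Real.exp (-(u * p.1)))) (σ, ω) =
        (Set.Ioi (H y ω)).indicator (fun σ => ENNReal.ofReal (Real.exp (-(u * σ)))) σ :=
      fun σ => rfl
    simp_rw [h3]
    rw [setLIntegral_indicator measurableSet_Ioi, Set.Ioi_inter_Ioi, max_eq_left (hω y),
      lintegral_Ioi_exp hu, div_eq_mul_inv, ENNReal.ofReal_mul (Real.exp_pos _).le]
  rw [lintegral_congr_ae h2, lintegral_mul_const' _ _ ENNReal.ofReal_ne_top, hH.lintegral_exp y hu,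
    ← ENNReal.ofReal_mul (Real.exp_pos _).le, ← div_eq_mul_inv]

/-- By duality and layer cake the left side is the `r`-th moment of `L(s)`. As functions of `s` both
sides have Laplace transform `r! u ^ (-(α r + 1))`. -/
theorem IsStableSubordinator.lintegral_measure_lt_mul_rpow [IsProbabilityMeasure P] {H : ℝ≥0 → Ω → ℝ}
    (hH : IsStableSubordinator α H P) (hα : 0 < α) {r : ℕ} (hr : 0 < r) {s : ℝ} (hs : 0 < s) :
    ENNReal.ofReal r * ∫⁻ y in Set.Ioi (0 : ℝ),
      P {ω | H y.toNNReal ω < s} * ENNReal.ofReal (y ^ ((r : ℝ) - 1)) =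
      ENNReal.ofReal ((r ! : ℝ) / Real.Gamma (α * r + 1) * s ^ (α * r)) := by
  have hr' : (0 : ℝ) < r := by exact_mod_cast hr
  have hG : 0 < Real.Gamma (α * r + 1) := Real.Gamma_pos_of_pos (by positivity)
  let f : ℝ → ℝ≥0∞ := fun σ => ENNReal.ofReal r * ∫⁻ y in Set.Ioi (0 : ℝ),
    P {ω | H y.toNNReal ω < σ} * ENNReal.ofReal (y ^ ((r : ℝ) - 1))
  let g : ℝ → ℝ≥0∞ := fun σ =>
    ENNReal.ofReal ((r ! : ℝ) / Real.Gamma (α * r + 1) * σ ^ (α * r))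
  have hjoint : Measurable fun p : ℝ × ℝ =>
      P {ω | H p.2.toNNReal ω < p.1} * ENNReal.ofReal (p.2 ^ ((r : ℝ) - 1)) :=
    hH.measurable_measure_lt.mul (by fun_prop)
  have hf : Measurable f := hjoint.lintegral_prod_right'.const_mul _
  have hg : Measurable g := by fun_prop
  have hmono : Monotone f := fun a b hab => by
    refine mul_le_mul_right (lintegral_mono fun y => mul_le_mul_left ?_ _) _
    exact measure_mono fun ω hω => lt_of_lt_of_le hω hab
  have hLf : ∀ u : ℝ, 0 < u → ∫⁻ σ in Set.Ioi (0 : ℝ),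
      ENNReal.ofReal (Real.exp (-(u * σ))) * f σ =
      ENNReal.ofReal ((r ! : ℝ) * u ^ (-(α * r + 1))) := by
    intro u hu
    have h1 : ∀ σ : ℝ, ENNReal.ofReal (Real.exp (-(u * σ))) * f σ =
        ENNReal.ofReal r * ∫⁻ y in Set.Ioi (0 : ℝ), ENNReal.ofReal (Real.exp (-(u * σ))) *
          (P {ω | H y.toNNReal ω < σ} * ENNReal.ofReal (y ^ ((r : ℝ) - 1))) := fun σ => by
      rw [lintegral_const_mul' _ _ ENNReal.ofReal_ne_top, mul_left_comm]
    simp_rw [h1]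
    rw [lintegral_const_mul' _ _ ENNReal.ofReal_ne_top, lintegral_lintegral_swap
      (f := fun σ y => ENNReal.ofReal (Real.exp (-(u * σ))) *
          (P {ω | H y.toNNReal ω < σ} * ENNReal.ofReal (y ^ ((r : ℝ) - 1))))
      (((by fun_prop : Measurable fun p : ℝ × ℝ =>
        ENNReal.ofReal (Real.exp (-(u * p.1)))).mul hjoint).aemeasurable)]
    have h2 : ∀ y ∈ Set.Ioi (0 : ℝ), ∫⁻ σ in Set.Ioi (0 : ℝ),
        ENNReal.ofReal (Real.exp (-(u * σ))) *
          (P {ω | H y.toNNReal ω < σ} * ENNReal.ofReal (y ^ ((r : ℝ) - 1))) =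
        ENNReal.ofReal u⁻¹ *
          ENNReal.ofReal (y ^ ((r : ℝ) - 1) * Real.exp (-(u ^ α * y))) := by
      intro y hy
      have hy0 : (0 : ℝ) ≤ y := le_of_lt hy
      simp_rw [← mul_assoc]
      rw [lintegral_mul_const' _ _ ENNReal.ofReal_ne_top, hH.laplace_measure_lt _ hu,
        Real.coe_toNNReal y hy0, ← ENNReal.ofReal_mul (by positivity),
        ← ENNReal.ofReal_mul (by positivity)]
      congr 1
      rw [mul_comm y]
      ring
    rw [setLIntegral_congr_fun measurableSet_Ioi h2, lintegral_const_mul' _ _ ENNReal.ofReal_ne_top,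
      lintegral_Ioi_rpow_mul_exp hr' (by positivity), ← ENNReal.ofReal_mul (by positivity),
      ← ENNReal.ofReal_mul (by positivity), ← Real.rpow_mul hu.le]
    congr 1
    obtain ⟨n, rfl⟩ := Nat.exists_eq_succ_of_ne_zero hr.ne'
    rw [neg_add, Real.rpow_add hu, Real.rpow_neg_one, Nat.factorial_succ, Nat.succ_eq_add_one]
    push_cast
    rw [Real.Gamma_nat_eq_factorial, mul_neg]
    ring
  have hLg : ∀ u : ℝ, 0 < u → ∫⁻ σ in Set.Ioi (0 : ℝ),
      ENNReal.ofReal (Real.exp (-(u * σ))) * g σ =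
      ENNReal.ofReal ((r ! : ℝ) * u ^ (-(α * r + 1))) := by
    intro u hu
    have h1 : ∀ σ : ℝ, ENNReal.ofReal (Real.exp (-(u * σ))) * g σ =
        ENNReal.ofReal ((r ! : ℝ) / Real.Gamma (α * r + 1)) *
          ENNReal.ofReal (σ ^ ((α * r + 1) - 1) * Real.exp (-(u * σ))) := fun σ => by
      rw [← ENNReal.ofReal_mul (Real.exp_pos _).le, ← ENNReal.ofReal_mul (by positivity),
        add_sub_cancel_right]
      congr 1
      ring
    simp_rw [h1]
    rw [lintegral_const_mul' _ _ ENNReal.ofReal_ne_top,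
      lintegral_Ioi_rpow_mul_exp (by positivity) hu, ← ENNReal.ofReal_mul (by positivity)]
    congr 1
    field_simp
  refine eq_of_ae_eq_of_monotone (f := f) (g := g) hmono (ae_eq_of_laplace_eq hf hg ?_ fun u hu => ?_)
    hs ?_
  · rw [hLf 1 one_pos]
    exact ENNReal.ofReal_ne_top
  · rw [hLf u hu, hLg u hu]
  · exact ENNReal.continuous_ofReal.continuousAt.comp
      (continuousAt_const.mul (Real.continuousAt_rpow_const _ _ (Or.inl hs.ne')))

/-! ### Inverse stable subordinators -/

/-- `L s` is an infimum over an uncountable set; each event `y < L s` agrees only up to a null set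
with the measurable event `H y < s`. -/
theorem IsInverseStable.aemeasurable {L : ℝ≥0 → Ω → ℝ≥0} (hL : IsInverseStable α L P)
    (s : ℝ≥0) : AEMeasurable (L s) P := by
  obtain ⟨H, hH, hLH⟩ := hL
  have hnull : NullMeasurable (L s) P := by
    refine @measurable_of_Ioi ℝ≥0 (NullMeasurableSpace Ω P) _ _ _ _ _ _ _ _ fun y => ?_
    have hm : MeasurableSet {ω | H y ω < s} :=
      measurableSet_lt (hH.levy.measurable y) measurable_const
    have hae : {ω : Ω | H y ω < s} =ᵐ[P] {ω | y < L s ω} := by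
      filter_upwards [hH.ae_lt_sInf_iff] with ω hω
      exact propext (show H y ω < s ↔ y < L s ω by rw [hLH, hω])
    exact NullMeasurableSet.congr hm.nullMeasurableSet hae
  exact hnull.aemeasurable

/-- The moments of the inverse stable subordinator: `E L(s) ^ r = r! s ^ (α r) / Γ(α r + 1)`. -/
theorem IsInverseStable.lintegral_pow [IsProbabilityMeasure P] {L : ℝ≥0 → Ω → ℝ≥0} (hL : IsInverseStable α L P)
    (hα : 0 < α) (s : ℝ≥0) (r : ℕ) :
    ∫⁻ ω, ENNReal.ofReal ((L s ω : ℝ) ^ r) ∂P =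
      ENNReal.ofReal ((r ! : ℝ) / Real.Gamma (α * r + 1) * ((s : ℝ) ^ α) ^ r) := by
  have hm := hL.aemeasurable s
  obtain ⟨H, hH, hLH⟩ := hL
  rcases Nat.eq_zero_or_pos r with rfl | hr
  · simp
  rcases eq_or_ne s 0 with rfl | hs
  · have h0 : ∀ᵐ ω ∂P, ENNReal.ofReal ((L 0 ω : ℝ) ^ r) = 0 := by
      filter_upwards [hH.ae_nonneg] with ω hω
      have : L 0 ω = 0 := by
        rw [hLH, ← le_zero_iff]
        exact csInf_le (s := {r : ℝ≥0 | ((0 : ℝ≥0) : ℝ) ≤ H r ω}) (OrderBot.bddBelow _) (hω 0)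
      simp [this, hr.ne']
    rw [lintegral_congr_ae h0]
    simp [Real.zero_rpow hα.ne', hr.ne']
  have hs' : (0 : ℝ) < s := by exact_mod_cast pos_iff_ne_zero.2 hs
  have h := lintegral_rpow_eq_lintegral_meas_lt_mul P (f := fun ω => (L s ω : ℝ))
    (ae_of_all _ fun ω => NNReal.coe_nonneg _) hm.coe_nnreal_real
    (p := r) (by exact_mod_cast hr)
  simp only [Real.rpow_natCast] at h
  rw [h, ← Real.rpow_natCast, ← Real.rpow_mul hs'.le,
    ← hH.lintegral_measure_lt_mul_rpow hα hr hs']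
  congr 1
  refine setLIntegral_congr_fun measurableSet_Ioi fun y hy => ?_
  refine congrArg (· * _) (measure_congr ?_)
  filter_upwards [hH.ae_lt_sInf_iff] with ω hω
  refine propext (show y < (L s ω : ℝ) ↔ H y.toNNReal ω < s from ?_)
  rw [← hω s y.toNNReal, ← hLH, ← NNReal.coe_lt_coe, Real.coe_toNNReal y (le_of_lt hy)]

end Subordinator

/-! ### Random time changes -/

section TimeChange

variable {Ω : Type*} [MeasurableSpace Ω] {P : Measure Ω}

/-- Total probability over the countably many values of `N`, computed with a measurable version of
`N`. -/
theorem measure_random_index {ι : Type*} [Countable ι] [MeasurableSpace ι]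
    [MeasurableSingletonClass ι] {N : Ω → ι} (hN : AEMeasurable N P) {A : ι → Set Ω}
    (hA : ∀ i, MeasurableSet (A i)) {p : ι → ℝ≥0∞}
    (h : ∀ i, P (A i ∩ N ⁻¹' {i}) = p i * P (N ⁻¹' {i})) :
    P {ω | ω ∈ A (N ω)} = ∫⁻ ω, p (N ω) ∂P := by
  have hN' := hN.measurable_mk
  have hset : {ω | ω ∈ A (N ω)} =ᵐ[P] ⋃ i, A i ∩ hN.mk N ⁻¹' {i} := by
    filter_upwards [hN.ae_eq_mk] with ω hω
    exact propext (show ω ∈ A (N ω) ↔ ω ∈ ⋃ i, A i ∩ hN.mk N ⁻¹' {i} by simp [hω])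
  have hpre : ∀ i, N ⁻¹' {i} =ᵐ[P] hN.mk N ⁻¹' {i} := fun i => by
    filter_upwards [hN.ae_eq_mk] with ω hω
    exact propext (show N ω = i ↔ hN.mk N ω = i by rw [hω])
  rw [measure_congr hset, measure_iUnion, show ∫⁻ ω, p (N ω) ∂P = ∫⁻ ω, p (hN.mk N ω) ∂P from
      lintegral_congr_ae (hN.ae_eq_mk.fun_comp p), ← lintegral_map (measurable_of_countable p) hN', lintegral_countable']
  · refine tsum_congr fun i => ?_
    rw [Measure.map_apply hN' (measurableSet_singleton i), ← measure_congr (hpre i), ← h i]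
    exact measure_congr ((ae_eq_refl _).inter (hpre i).symm)
  · intro i j hij
    refine Set.disjoint_left.2 fun ω hi hj => hij ?_
    exact hi.2.symm.trans hj.2
  · exact fun i => (hA i).inter (hN' (measurableSet_singleton i))

theorem aemeasurable_random_index {ι E : Type*} [Countable ι] [MeasurableSpace ι]
    [MeasurableSingletonClass ι] [MeasurableSpace E] {N : Ω → ι} (hN : AEMeasurable N P)
    {X : ι → Ω → E} (hX : ∀ i, Measurable (X i)) : AEMeasurable (fun ω => X (N ω) ω) P := by
  have h1 : Measurable fun q : ι × Ω => X q.1 q.2 := measurable_from_prod_countable_right hX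
  refine ⟨fun ω => X (hN.mk N ω) ω, h1.comp (hN.measurable_mk.prodMk measurable_id), ?_⟩
  filter_upwards [hN.ae_eq_mk] with ω hω
  rw [hω]

omit [MeasurableSpace Ω] in
theorem measurableSet_sigmaOf {T E : Type*} [MeasurableSpace E] (X : T → Ω → E) (t : T) {B : Set E}
    (hB : MeasurableSet B) : MeasurableSet[sigmaOf X] (X t ⁻¹' B) :=
  le_iSup (fun t => MeasurableSpace.comap (X t) inferInstance) t _ ⟨B, hB, rfl⟩

theorem measure_inter_of_iIndep {m₁ m₂ m₃ m₄ : MeasurableSpace Ω} (h : iIndep ![m₁, m₂, m₃, m₄] P)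
    {A B C D : Set Ω} (hA : MeasurableSet[m₁] A) (hB : MeasurableSet[m₂] B)
    (hC : MeasurableSet[m₃] C) (hD : MeasurableSet[m₄] D) :
    P ((A ∩ B) ∩ (C ∩ D)) = (P A * P B) * (P C * P D) := by
  have h1 := h.meas_iInter (s := ![A, B, C, D]) (by
    intro i
    fin_cases i <;> assumption)
  have h2 : ⋂ i, ![A, B, C, D] i = (A ∩ B) ∩ (C ∩ D) := by
    ext ω
    simp [Fin.forall_fin_succ, and_assoc]
  rw [h2] at h1
  rw [h1]
  simp [Fin.prod_univ_succ, mul_assoc]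

variable [IsProbabilityMeasure P] {k : ℕ} {lam₁ lam₂ : Fin k → ℝ} {M₁ M₂ : ℝ≥0 × ℝ≥0 → Ω → ℕ}
  {L K : ℝ≥0 → Ω → ℝ≥0}

omit [IsProbabilityMeasure P] in
-- In the discrete space `ℕ` convergence along the grid means eventual equality.
theorem IsGPRF.ae_tendsto_gridPoint (hM : IsGPRF lam₁ M₁ P) : ∀ᵐ ω ∂P, ∀ u v : ℝ≥0,
    ∀ᶠ n in atTop, M₁ (gridPoint n (gridIndex n u), gridPoint n (gridIndex n v)) ω =
      M₁ (u, v) ω := by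
  filter_upwards [hM.right_cont] with ω hω u v
  have h1 : Tendsto (fun n => (gridPoint n (gridIndex n u), gridPoint n (gridIndex n v))) atTop
      (𝓝[≥] (u, v)) := by
    rw [← Set.Ici_prod_Ici, nhdsWithin_prod_eq]
    exact (tendsto_gridPoint u).prodMk (tendsto_gridPoint v)
  have h2 := (hω (u, v)).tendsto.comp h1
  rw [nhds_discrete, tendsto_pure] at h2
  exact h2

omit [IsProbabilityMeasure P] in
theorem IsGPRF.aemeasurable_comp (hM : IsGPRF lam₁ M₁ P) {U V : Ω → ℝ≥0} (hU : AEMeasurable U P)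
    (hV : AEMeasurable V P) : AEMeasurable (fun ω => M₁ (U ω, V ω) ω) P := by
  refine aemeasurable_of_tendsto_metrizable_ae atTop (f := fun n ω =>
    M₁ (gridPoint n (gridIndex n (U ω)), gridPoint n (gridIndex n (V ω))) ω) (fun n => ?_) ?_
  · exact aemeasurable_random_index
      (N := fun ω => (gridIndex n (U ω), gridIndex n (V ω)))
      (X := fun (i : ℕ × ℕ) ω => M₁ (gridPoint n i.1, gridPoint n i.2) ω)
      (((measurable_gridIndex n).comp_aemeasurable hU).prodMk
        ((measurable_gridIndex n).comp_aemeasurable hV)) fun i => hM.measurable _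
  · filter_upwards [hM.ae_tendsto_gridPoint] with ω hω
    rw [nhds_discrete, tendsto_pure]
    exact hω _ _

/-- The probability that the two fields take the values `a` and `b` at the point `q`. -/
noncomputable def jointMass (lam₁ lam₂ : Fin k → ℝ) (a b : ℕ) (q : ℝ≥0 × ℝ≥0) : ℝ≥0∞ :=
  ENNReal.ofReal (gprfMass lam₁ ((q.1 : ℝ) * q.2) a) *
    ENNReal.ofReal (gprfMass lam₂ ((q.1 : ℝ) * q.2) b)

theorem continuous_jointMass (h₁ : ∀ j, 0 < lam₁ j) (a b : ℕ) :
    Continuous (jointMass lam₁ lam₂ a b) := by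
  have h2 : Continuous fun q : ℝ≥0 × ℝ≥0 => ENNReal.ofReal
      (gprfMass lam₁ ((q.1 : ℝ) * q.2) a * gprfMass lam₂ ((q.1 : ℝ) * q.2) b) :=
    ENNReal.continuous_ofReal.comp
      (((continuous_gprfMass lam₁ a).comp (by fun_prop)).mul
        ((continuous_gprfMass lam₂ b).comp (by fun_prop)))
  refine h2.congr fun q => ?_
  rw [ENNReal.ofReal_mul (gprfMass_nonneg h₁ (by positivity) _), jointMass]

theorem jointMass_le_one (hM₁ : IsGPRF lam₁ M₁ P) (hM₂ : IsGPRF lam₂ M₂ P) (a b : ℕ)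
    (q : ℝ≥0 × ℝ≥0) : jointMass lam₁ lam₂ a b q ≤ 1 := by
  rw [jointMass, ← hM₁.prob_eq, ← hM₂.prob_eq]
  exact mul_le_one' prob_le_one prob_le_one

/-- The joint law of two independent fields at an independent random grid point. -/
theorem measure_gridPoint_eq (hM₁ : IsGPRF lam₁ M₁ P) (hM₂ : IsGPRF lam₂ M₂ P) {s t : ℝ≥0}
    (hL : AEMeasurable (L s) P) (hK : AEMeasurable (K t) P)
    (hindep : iIndep ![sigmaOf M₁, sigmaOf M₂, sigmaOf L, sigmaOf K] P) (a b n : ℕ) :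
    P {ω | M₁ (gridPoint n (gridIndex n (L s ω)), gridPoint n (gridIndex n (K t ω))) ω = a ∧
      M₂ (gridPoint n (gridIndex n (L s ω)), gridPoint n (gridIndex n (K t ω))) ω = b} =
      ∫⁻ ω, jointMass lam₁ lam₂ a b
        (gridPoint n (gridIndex n (L s ω)), gridPoint n (gridIndex n (K t ω))) ∂P := by
  have hN : AEMeasurable (fun ω => (gridIndex n (L s ω), gridIndex n (K t ω))) P :=
    ((measurable_gridIndex n).comp_aemeasurable hL).prodMk
      ((measurable_gridIndex n).comp_aemeasurable hK)
  refine measure_random_index hN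
    (A := fun i : ℕ × ℕ => {ω | M₁ (gridPoint n i.1, gridPoint n i.2) ω = a ∧
      M₂ (gridPoint n i.1, gridPoint n i.2) ω = b})
    (p := fun i : ℕ × ℕ => jointMass lam₁ lam₂ a b (gridPoint n i.1, gridPoint n i.2)) (fun i =>
      (hM₁.measurable _ (measurableSet_singleton a)).inter
        (hM₂.measurable _ (measurableSet_singleton b))) fun i => ?_
  have hpre : (fun ω => (gridIndex n (L s ω), gridIndex n (K t ω))) ⁻¹' {i} =
      L s ⁻¹' (gridIndex n ⁻¹' {i.1}) ∩ K t ⁻¹' (gridIndex n ⁻¹' {i.2}) := by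
    ext ω
    simp [Prod.ext_iff]
  have hC := measurableSet_sigmaOf L s (measurable_gridIndex n (measurableSet_singleton i.1))
  have hD := measurableSet_sigmaOf K t (measurable_gridIndex n (measurableSet_singleton i.2))
  have h1 := measure_inter_of_iIndep hindep
    (measurableSet_sigmaOf M₁ (gridPoint n i.1, gridPoint n i.2) (measurableSet_singleton a))
    (measurableSet_sigmaOf M₂ (gridPoint n i.1, gridPoint n i.2) (measurableSet_singleton b))
    hC hD
  -- Taking whole-space events for the two fields yields the product formula for the pair `L`, `K`.
  have h2 := measure_inter_of_iIndep hindep MeasurableSet.univ MeasurableSet.univ hC hD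
  simp only [Set.univ_inter, measure_univ, one_mul] at h2
  rw [hpre, h2, jointMass, ← hM₁.prob_eq, ← hM₂.prob_eq]
  exact h1

/-- The joint law of two independent fields at an independent random point. -/
theorem measure_timeChange_eq (hM₁ : IsGPRF lam₁ M₁ P) (hM₂ : IsGPRF lam₂ M₂ P) {s t : ℝ≥0}
    (hL : AEMeasurable (L s) P) (hK : AEMeasurable (K t) P)
    (hindep : iIndep ![sigmaOf M₁, sigmaOf M₂, sigmaOf L, sigmaOf K] P) (a b : ℕ) :
    P {ω | M₁ (L s ω, K t ω) ω = a ∧ M₂ (L s ω, K t ω) ω = b} =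
      ∫⁻ ω, jointMass lam₁ lam₂ a b (L s ω, K t ω) ∂P := by
  have hp := continuous_jointMass (lam₂ := lam₂) hM₁.rate_pos a b
  have hY : ∀ (n : ℕ) {U : Ω → ℝ≥0}, AEMeasurable U P →
      AEMeasurable (fun ω => gridPoint n (gridIndex n (U ω))) P := fun n U hU =>
    (measurable_of_countable (gridPoint n)).comp_aemeasurable
      ((measurable_gridIndex n).comp_aemeasurable hU)
  have hX : ∀ {U V : Ω → ℝ≥0}, AEMeasurable U P → AEMeasurable V P →
      NullMeasurableSet {ω | M₁ (U ω, V ω) ω = a ∧ M₂ (U ω, V ω) ω = b} P := fun hU hV =>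
    ((hM₁.aemeasurable_comp hU hV).nullMeasurable (measurableSet_singleton a)).inter
      ((hM₂.aemeasurable_comp hU hV).nullMeasurable (measurableSet_singleton b))
  -- Both sides of the grid identity converge: the indicators are eventually constant on almost
  -- every path, and `jointMass` is continuous and at most 1.
  have hlim1 : Tendsto (fun n => P {ω |
      M₁ (gridPoint n (gridIndex n (L s ω)), gridPoint n (gridIndex n (K t ω))) ω = a ∧
      M₂ (gridPoint n (gridIndex n (L s ω)), gridPoint n (gridIndex n (K t ω))) ω = b}) atTop
      (𝓝 (P {ω | M₁ (L s ω, K t ω) ω = a ∧ M₂ (L s ω, K t ω) ω = b})) := by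
    simp_rw [← fun n => lintegral_indicator_one₀ (hX (hY n hL) (hY n hK))]
    rw [← lintegral_indicator_one₀ (hX hL hK)]
    refine tendsto_lintegral_of_dominated_convergence' (fun _ => 1)
      (fun n => aemeasurable_const.indicator₀ (hX (hY n hL) (hY n hK)))
      (fun n => ae_of_all _ fun ω => Set.indicator_le_self _ _ _) (by simp) ?_
    filter_upwards [hM₁.ae_tendsto_gridPoint, hM₂.ae_tendsto_gridPoint] with ω h1 h2
    refine tendsto_const_nhds.congr' ?_
    filter_upwards [h1 (L s ω) (K t ω), h2 (L s ω) (K t ω)] with n hn1 hn2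
    simp only [Set.indicator, Set.mem_ofPred_eq, hn1, hn2, Pi.one_apply]
  simp_rw [measure_gridPoint_eq hM₁ hM₂ hL hK hindep] at hlim1
  refine tendsto_nhds_unique hlim1 ?_
  refine tendsto_lintegral_of_dominated_convergence' (fun _ => 1)
    (fun n => hp.measurable.comp_aemeasurable ((hY n hL).prodMk (hY n hK)))
    (fun n => ae_of_all _ fun ω => jointMass_le_one hM₁ hM₂ a b _)
    (by simp) (ae_of_all _ fun ω => ?_)
  exact (hp.tendsto _).comp (((tendsto_gridPoint _).mono_right nhdsWithin_le_nhds).prodMk_nhds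
    ((tendsto_gridPoint _).mono_right nhdsWithin_le_nhds))

omit [IsProbabilityMeasure P] in
theorem aemeasurable_fracSkellam (hM₁ : IsGPRF lam₁ M₁ P) (hM₂ : IsGPRF lam₂ M₂ P) {s t : ℝ≥0}
    (hL : AEMeasurable (L s) P) (hK : AEMeasurable (K t) P) :
    AEMeasurable (fracSkellam M₁ M₂ L K s t) P :=
  (measurable_of_countable fun q : ℕ × ℕ => (q.1 : ℤ) - q.2).comp_aemeasurable
    ((hM₁.aemeasurable_comp hL hK).prodMk (hM₂.aemeasurable_comp hL hK))

/-- The probability generating function of the time-changed Skellam field, as a value in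
`[0, ∞]`. -/
theorem lintegral_zpow_fracSkellam (hM₁ : IsGPRF lam₁ M₁ P) (hM₂ : IsGPRF lam₂ M₂ P) {s t : ℝ≥0}
    (hL : AEMeasurable (L s) P) (hK : AEMeasurable (K t) P)
    (hindep : iIndep ![sigmaOf M₁, sigmaOf M₂, sigmaOf L, sigmaOf K] P) {z : ℝ} (hz : 0 < z) :
    ∫⁻ ω, ENNReal.ofReal (z ^ fracSkellam M₁ M₂ L K s t ω) ∂P =
      ∫⁻ ω, ENNReal.ofReal (Real.exp (-phi lam₁ lam₂ z * ((L s ω : ℝ) * K t ω))) ∂P := by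
  set X : Ω → ℕ × ℕ := fun ω => (M₁ (L s ω, K t ω) ω, M₂ (L s ω, K t ω) ω) with hXdef
  have hX : AEMeasurable X P :=
    (hM₁.aemeasurable_comp hL hK).prodMk (hM₂.aemeasurable_comp hL hK)
  -- With `z ^ (a - b) = z ^ a * z⁻¹ ^ b` everything is nonnegative, so sums over values and
  -- expectations interchange freely in `[0, ∞]`.
  let G : ℕ × ℕ → ℝ≥0∞ := fun q => ENNReal.ofReal (z ^ q.1) * ENNReal.ofReal (z⁻¹ ^ q.2)
  have hG : ∀ ω, ENNReal.ofReal (z ^ fracSkellam M₁ M₂ L K s t ω) = G (X ω) := fun ω => by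
    show _ = ENNReal.ofReal _ * ENNReal.ofReal _
    rw [← ENNReal.ofReal_mul (by positivity), fracSkellam, skellam, zpow_sub₀ hz.ne', zpow_natCast,
      zpow_natCast, inv_pow, div_eq_mul_inv]
  have hlaw : ∀ q : ℕ × ℕ, G q * P.map X {q} =
      ∫⁻ ω, ENNReal.ofReal (gprfMass lam₁ ((L s ω : ℝ) * K t ω) q.1 * z ^ q.1) *
        ENNReal.ofReal (gprfMass lam₂ ((L s ω : ℝ) * K t ω) q.2 * z⁻¹ ^ q.2) ∂P := by
    intro q
    rw [Measure.map_apply_of_aemeasurable hX (measurableSet_singleton q)]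
    have h1 : X ⁻¹' {q} = {ω | M₁ (L s ω, K t ω) ω = q.1 ∧ M₂ (L s ω, K t ω) ω = q.2} := by
      ext ω
      simp [hXdef, Prod.ext_iff]
    have h2 := (continuous_jointMass (lam₂ := lam₂) hM₁.rate_pos q.1
      q.2).measurable.comp_aemeasurable (hL.prodMk hK)
    rw [h1, measure_timeChange_eq hM₁ hM₂ hL hK hindep, ← lintegral_const_mul'' (f := fun ω =>
      jointMass lam₁ lam₂ q.1 q.2 (L s ω, K t ω)) _ h2]
    refine lintegral_congr fun ω => ?_
    rw [ENNReal.ofReal_mul (gprfMass_nonneg hM₁.rate_pos (by positivity) _),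
      ENNReal.ofReal_mul (gprfMass_nonneg hM₂.rate_pos (by positivity) _)]
    simp only [G, jointMass]
    ring
  simp_rw [hG]
  rw [← lintegral_map' (measurable_of_countable G).aemeasurable hX, lintegral_countable']
  simp_rw [hlaw]
  have hmass : ∀ (lam : Fin k → ℝ) (n : ℕ) (c : ℝ), AEMeasurable (fun ω =>
      ENNReal.ofReal (gprfMass lam ((L s ω : ℝ) * K t ω) n * c)) P := fun lam n c =>
    (((continuous_gprfMass lam n).measurable.comp_aemeasurable
      (hL.coe_nnreal_real.mul hK.coe_nnreal_real)).mul_const c).ennreal_ofReal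
  rw [← lintegral_tsum (f := fun (q : ℕ × ℕ) ω =>
    ENNReal.ofReal (gprfMass lam₁ ((L s ω : ℝ) * K t ω) q.1 * z ^ q.1) *
      ENNReal.ofReal (gprfMass lam₂ ((L s ω : ℝ) * K t ω) q.2 * z⁻¹ ^ q.2)) fun q =>
    (hmass lam₁ q.1 (z ^ q.1)).mul (hmass lam₂ q.2 (z⁻¹ ^ q.2))]
  refine lintegral_congr fun ω => ?_
  have hA : 0 ≤ (L s ω : ℝ) * K t ω := by positivity
  rw [ENNReal.tsum_prod (f := fun a b : ℕ =>
    ENNReal.ofReal (gprfMass lam₁ ((L s ω : ℝ) * K t ω) a * z ^ a) *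
      ENNReal.ofReal (gprfMass lam₂ ((L s ω : ℝ) * K t ω) b * z⁻¹ ^ b))]
  simp_rw [ENNReal.tsum_mul_left]
  rw [ENNReal.tsum_mul_right, tsum_gprfMass_mul_pow hM₁.rate_pos hA hz.le,
    tsum_gprfMass_mul_pow hM₂.rate_pos hA (inv_pos.2 hz).le,
    ← ENNReal.ofReal_mul (Real.exp_pos _).le, ← Real.exp_add, ← neg_add, ← mul_add,
    ← Finset.sum_add_distrib, neg_mul, mul_comm (phi _ _ _)]
  congr 4
  refine Finset.sum_congr rfl fun j _ => ?_
  rw [zpow_neg, inv_pow]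
  norm_cast

theorem lintegral_pow_mul_inverseStable {α β : ℝ} (hα : 0 < α) (hβ : 0 < β)
    (hL : IsInverseStable α L P) (hK : IsInverseStable β K P)
    (hindep : Indep (sigmaOf L) (sigmaOf K) P) (s t : ℝ≥0) (r : ℕ) :
    ∫⁻ ω, ENNReal.ofReal (((L s ω : ℝ) * K t ω) ^ r) ∂P =
      ENNReal.ofReal ((r ! : ℝ) / Real.Gamma (α * r + 1) * ((s : ℝ) ^ α) ^ r *
        ((r ! : ℝ) / Real.Gamma (β * r + 1) * ((t : ℝ) ^ β) ^ r)) := by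
  have hind : IndepFun (L s) (K t) P := (IndepFun_iff_Indep _ _ _).2 <|
    indep_of_indep_of_le_left (indep_of_indep_of_le_right hindep
      (le_iSup (fun t => MeasurableSpace.comap (K t) inferInstance) t))
      (le_iSup (fun s => MeasurableSpace.comap (L s) inferInstance) s)
  have hmeas : Measurable fun y : ℝ≥0 => ENNReal.ofReal ((y : ℝ) ^ r) := by fun_prop
  have h := lintegral_mul_eq_lintegral_mul_lintegral_of_indepFun''
    (hmeas.comp_aemeasurable (hL.aemeasurable s)) (hmeas.comp_aemeasurable (hK.aemeasurable t))
    (hind.comp hmeas hmeas)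
  have hG := Real.Gamma_pos_of_pos (by positivity : 0 < α * r + 1)
  simp only [Function.comp_def, hL.lintegral_pow hα, hK.lintegral_pow hβ] at h
  rw [ENNReal.ofReal_mul (by positivity), ← h]
  refine lintegral_congr fun ω => ?_
  rw [mul_pow, ENNReal.ofReal_mul (by positivity)]

end TimeChange

end FracSkellam

/-! ### The main theorem -/

theorem mainTheorem12 {Ω : Type*} [MeasurableSpace Ω] (P : Measure Ω) [IsProbabilityMeasure P]
    (α β : ℝ) (hα : α ∈ Set.Ioo (0 : ℝ) 1) (hβ : β ∈ Set.Ioo (0 : ℝ) 1)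
    (k : ℕ) (lam₁ lam₂ : Fin k → ℝ)
    (M₁ M₂ : ℝ≥0 × ℝ≥0 → Ω → ℕ) (L K : ℝ≥0 → Ω → ℝ≥0)
    (hM₁ : FracSkellam.IsGPRF lam₁ M₁ P) (hM₂ : FracSkellam.IsGPRF lam₂ M₂ P)
    (hL : FracSkellam.IsInverseStable α L P) (hK : FracSkellam.IsInverseStable β K P)
    (hindep : iIndep ![FracSkellam.sigmaOf M₁, FracSkellam.sigmaOf M₂,
      FracSkellam.sigmaOf L, FracSkellam.sigmaOf K] P)
    (z : ℝ) (hz : z ∈ Set.Ioc (0 : ℝ) 1) (s t : ℝ≥0)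
    (x : ℝ) (hx : x = -FracSkellam.phi lam₁ lam₂ z * (s : ℝ) ^ α * (t : ℝ) ^ β) :
    -- the identity, wherever the series of the generalized Wright function converges
    (FracSkellam.WrightConverges ![1, 1] ![1, 1] ![1, 1] ![α, β] x →
      Integrable (fun ω => z ^ FracSkellam.fracSkellam M₁ M₂ L K s t ω) P ∧
      ∫ ω, z ^ FracSkellam.fracSkellam M₁ M₂ L K s t ω ∂P =
        FracSkellam.wrightPsi ![1, 1] ![1, 1] ![1, 1] ![α, β] x) ∧
    -- the series converges in particular in these cases
    ((1 < α + β ∨ (α + β = 1 ∧ |x| < α ^ α * β ^ β)) →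
      FracSkellam.WrightConverges ![1, 1] ![1, 1] ![1, 1] ![α, β] x) ∧
    -- for a nonnegative argument the identity holds in `[0, ∞]` without restriction
    (0 ≤ x →
      ∫⁻ ω, ENNReal.ofReal (z ^ FracSkellam.fracSkellam M₁ M₂ L K s t ω) ∂P =
        ∑' r : ℕ, ENNReal.ofReal (FracSkellam.wrightTerm ![1, 1] ![1, 1] ![1, 1] ![α, β] x r)) := by
  open FracSkellam in
  set c := -phi lam₁ lam₂ z with hc
  set W : Ω → ℝ := fun ω => (L s ω : ℝ) * K t ω with hW
  set m : ℕ → ℝ := fun r => (r ! : ℝ) / Real.Gamma (α * r + 1) * ((s : ℝ) ^ α) ^ r *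
    ((r ! : ℝ) / Real.Gamma (β * r + 1) * ((t : ℝ) ^ β) ^ r) with hm
  have hLm := hL.aemeasurable s
  have hKm := hK.aemeasurable t
  have hWm : AEMeasurable W P := hLm.coe_nnreal_real.mul hKm.coe_nnreal_real
  have hW0 : ∀ᵐ ω ∂P, 0 ≤ W ω := ae_of_all _ fun ω => by positivity
  have hm0 : ∀ r, 0 ≤ m r := fun r => by
    have h1 := Real.Gamma_pos_of_pos
      (add_pos_of_nonneg_of_pos (mul_nonneg hα.1.le (Nat.cast_nonneg r)) one_pos)
    have h2 := Real.Gamma_pos_of_pos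
      (add_pos_of_nonneg_of_pos (mul_nonneg hβ.1.le (Nat.cast_nonneg r)) one_pos)
    positivity
  have hmom : ∀ r : ℕ, ∫⁻ ω, ENNReal.ofReal (W ω ^ r) ∂P = ENNReal.ofReal (m r) :=
    lintegral_pow_mul_inverseStable hα.1 hβ.1 hL hK
      (hindep.indep (show (2 : Fin 4) ≠ 3 by decide)) s t
  -- The Wright series at `x` is the moment series at any `d` representing `x`. The freedom in `d`
  -- is used when `s ^ α t ^ β = 0`.
  have hterm' : ∀ d : ℝ, x = d * (s : ℝ) ^ α * (t : ℝ) ^ β → ∀ r : ℕ,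
      wrightTerm ![1, 1] ![1, 1] ![1, 1] ![α, β] x r = d ^ r * (m r / (r ! : ℝ)) := fun d hd r => by
    have h0 : (r ! : ℝ) ≠ 0 := by positivity
    rw [wrightTerm_eq, hd, mul_pow, mul_pow]
    simp only [hm]
    field_simp
  have hterm := hterm' c hx
  have hpgf := lintegral_zpow_fracSkellam hM₁ hM₂ hLm hKm hindep hz.1
  have hzpos : ∀ ω, 0 ≤ z ^ fracSkellam M₁ M₂ L K s t ω := fun ω => (zpow_pos hz.1 _).le
  have hSm : AEStronglyMeasurable (fun ω => z ^ fracSkellam M₁ M₂ L K s t ω) P :=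
    ((measurable_of_countable fun n : ℤ => z ^ n).comp_aemeasurable
      (aemeasurable_fracSkellam hM₁ hM₂ hLm hKm)).aestronglyMeasurable
  refine ⟨?_, ?_, fun hx0 => ?_⟩
  · rintro ⟨v, hv⟩
    have hv' := hv
    simp only [hterm] at hv'
    obtain ⟨hint, hval⟩ := integral_exp_of_tendsto_moments hWm hW0 hm0 hmom hv'
    refine ⟨⟨hSm, ?_⟩, ?_⟩
    · rw [hasFiniteIntegral_iff_ofReal (ae_of_all _ hzpos), hpgf]
      exact (hasFiniteIntegral_iff_ofReal (ae_of_all _ fun ω => (Real.exp_pos _).le)).1 hint.2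
    · rw [wrightPsi, hv.limUnder_eq, ← hval, integral_eq_lintegral_of_nonneg_ae
        (ae_of_all _ hzpos) hSm, hpgf, integral_eq_lintegral_of_nonneg_ae
        (ae_of_all _ fun ω => (Real.exp_pos _).le) hint.1]
  · rintro (h | ⟨h1, h2⟩)
    · exact wrightConverges_of_one_lt hα.1 hβ.1 h x
    · exact wrightConverges_of_abs_lt hα.1 hβ.1 h1 h2
  · rw [hpgf]
    -- If this product vanishes, `0 ≤ x` says nothing about the sign of `c`. But then `W` has zero
    -- first moment, hence vanishes almost surely, and `c` may be replaced by 0.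
    rcases eq_or_ne ((s : ℝ) ^ α * (t : ℝ) ^ β) 0 with h0 | h0
    · have hm1 : m 1 = 0 := by
        rw [show m 1 = (s : ℝ) ^ α * (t : ℝ) ^ β * (((1 ! : ℕ) : ℝ) / Real.Gamma (α * (1 : ℕ) + 1) *
          (((1 ! : ℕ) : ℝ) / Real.Gamma (β * (1 : ℕ) + 1))) by simp only [hm, pow_one]; ring,
          h0, zero_mul]
      have hWz : ∀ᵐ ω ∂P, W ω = 0 := by
        have h1 := hmom 1
        simp only [pow_one, hm1, ENNReal.ofReal_zero] at h1
        filter_upwards [(lintegral_eq_zero_iff' hWm.ennreal_ofReal).1 h1, hW0] with ω h2 h3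
        exact le_antisymm (ENNReal.ofReal_eq_zero.1 h2) h3
      simp only [hterm' 0 (by rw [hx, mul_assoc, h0, mul_zero, zero_mul, zero_mul])]
      rw [← lintegral_exp_eq_tsum_moments hWm hW0 hmom le_rfl]
      refine lintegral_congr_ae ?_
      filter_upwards [hWz] with ω hω
      rw [show (L s ω : ℝ) * K t ω = W ω from rfl, hω, mul_zero, mul_zero]
    · have hc0 : 0 ≤ c := by
        rw [hx, mul_assoc] at hx0
        exact nonneg_of_mul_nonneg_left hx0 (lt_of_le_of_ne (by positivity) h0.symm)
      simp only [hterm]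
      exact lintegral_exp_eq_tsum_moments hWm hW0 hmom hc0
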